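/- **Setting.** Let $p=q+s$ with $q\in\mathbb N_0$ and $0<s\le 1$. A function $F:[-2,2]\to\mathbb R$ is called $(p,C_0)$-smooth if its $q$-th derivative exists on $[-2,2]$ and $|F^{(q)}(x)-F^{(q)}(y)|\le C_0|x-y|^s$ for all $x,y\in[-2,2]$; $\|F\|_{C^q([-2,2])}=\max_{0\le j\le q}\max_{y\in[-2,2]}|F^{(j)}(y)|$. Let $\mathcal F(L,\iota,\delta)$ be the set of functions $\mathbb R\to\mathbb R$ computed by fully connected neural networks with $L$ hidden layers of $\iota$ neurons each, sigmoid activation $t\mapsto 1/(1+e^{-t})$, and an affine output unit, all of whose weights and biases have absolute value at most $\delta$. For $\Phi:\mathbb R^d\to\mathbb R$ let $\widetilde{\mathcal F}_\Phi(1,L,\iota,\delta)$ be the set of functions $x\mapsto W\,g(\Phi(x))+b$ with $g\in\mathcal F(L,\iota,\delta)$ and $W,b\in\mathbb R$. **Theorem.** For every $p=q+s$ as above there are constants $c_2,c_3,c_6>0$ such that for all $C_0,C_1>0$ there is a constant $C_2'>0$ with the following property. Let $F:[-2,2]\to\mathbb R$ be $(p,C_0)$-smooth with $\|F\|_{C^q([-2,2])}\le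 C_1$, let $M\in\mathbb N$ satisfy $$M^{2p}\ge\max\{2c_2(\max\{1,C_1\})^{5q+3},\,c_3,\,12\},$$ and put $$L=8+\lceil\log_2(q+1)\rceil,$$ $$\iota=2\bigl(\max\{4(q+2)M+1,\;4(q+1)^2\}+4M+12\bigr),$$ $$\delta=c_6\,e^{192}\,M^{10p+12}\,(\max\{1,C_1\})^{12}.$$ Then for every dimension $d$ and every frequency vector $k\in\mathbb R^d$: 1. if $f(x)=F(\sin(k\cdot x))$ and $\Phi(x)=\sin(k\cdot x)$, there is $f_{\rm net}\in\widetilde{\mathcal F}_\Phi(1,L,\iota,\delta)$ with $\displaystyle\sup_{x\in[-\pi,\pi]^d}|f_{\rm net}(x)-f(x)|\le \frac{C_2'}{M^{2p}}$; 2. if $f(x)=F(\cos(k\cdot x))$ and $\Phi(x)=\cos(k\cdot x)$, there is $f_{\rm net}\in\widetilde{\mathcal F}_\Phi(1,L,\iota,\delta)$ with $\displaystyle\sup_{x\in[-\pi,\pi]^d}|f_{\rm net}(x)-f(x)|\le \frac{C_2'}{M^{2p}}$. In particular all the constants, and $L$, $\iota$, $\delta$, are independent of the frequency vector $k$. -/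

import Mathlib

/-- `F` is `(p, C₀)`-smooth on the set `S ⊆ ℝ`, where `p = q + s`: the derivative of order `q` of `F`
exists on `S` (one-sided at an end point of an interval) and is `s`-Hölder with constant `C₀`. -/
def HolderSmoothOn (q : ℕ) (s C₀ : ℝ) (F : ℝ → ℝ) (S : Set ℝ) : Prop :=
  (∀ j : ℕ, j < q → DifferentiableOn ℝ (iteratedDerivWithin j F S) S) ∧
    ∀ x ∈ S, ∀ y ∈ S,
      |iteratedDerivWithin q F S x - iteratedDerivWithin q F S y| ≤ C₀ * |x - y| ^ s

/-- The parameters `θ` (weights and biases) of a fully connected network with input dimension `D`,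
`L` hidden layers of `ι` neurons each, and one affine output unit. -/
inductive DenseNet (ι : ℕ) : (D L : ℕ) → Type
  | output {D : ℕ} (w : Fin D → ℝ) (c : ℝ) : DenseNet ι D 0
  | layer {D L : ℕ} (A : Matrix (Fin ι) (Fin D) ℝ) (b : Fin ι → ℝ) (rest : DenseNet ι ι L) :
      DenseNet ι D (L + 1)

namespace DenseNet

/-- The function computed by the network with sigmoid activation `t ↦ 1 / (1 + exp (-t))`. -/
noncomputable def eval {ι : ℕ} : {D L : ℕ} → DenseNet ι D L → (Fin D → ℝ) → ℝ
  | _, _, output w c, x => (∑ i, w i * x i) + c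
  | _, _, layer A b rest, x => rest.eval fun i => Real.sigmoid ((∑ j, A i j * x j) + b i)

/-- `‖θ‖_∞ ≤ δ`: all weights and biases are at most `δ` in absolute value. -/
def ParamBound {ι : ℕ} (δ : ℝ) : {D L : ℕ} → DenseNet ι D L → Prop
  | _, _, output w c => (∀ i, |w i| ≤ δ) ∧ |c| ≤ δ
  | _, _, layer A b rest => (∀ i j, |A i j| ≤ δ) ∧ (∀ i, |b i| ≤ δ) ∧ rest.ParamBound δ

end DenseNet

/-- The network class `𝓕(L, ι, δ)` on inputs in `ℝ^D`. -/
def NetClass (D L ι : ℕ) (δ : ℝ) : Set ((Fin D → ℝ) → ℝ) :=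
  {f | ∃ θ : DenseNet ι D L, θ.ParamBound δ ∧ f = θ.eval}

/-- The feature mapping network class `𝓕~(N, L, ι, δ)` for the feature mapping
`Φ = (Φ_1, …, Φ_N)` on `ℝ^d`, `Φ_i : ℝ^d → ℝ^D`: the functions
`∑ i, W_i * g_i (Φ_i x) + b` with every `g_i` in `𝓕(L, ι, δ)`. -/
def FeatureNetClass {d D N : ℕ} (Φ : Fin N → (Fin d → ℝ) → (Fin D → ℝ)) (L ι : ℕ) (δ : ℝ) :
    Set ((Fin d → ℝ) → ℝ) :=
  {f | ∃ (W : Fin N → ℝ) (b : ℝ) (g : Fin N → (Fin D → ℝ) → ℝ),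
    (∀ i, g i ∈ NetClass D L ι δ) ∧ f = fun x => (∑ i, W i * g i (Φ i x)) + b}

/-- A scalar function on `ℝ^d` as a single feature (`N = 1`, `D = 1`). -/
def singleFeature {d : ℕ} (φ : (Fin d → ℝ) → ℝ) : Fin 1 → (Fin d → ℝ) → (Fin 1 → ℝ) :=
  fun _ x _ => φ x

/-- The depth `C₄(d, q) = 8 + ⌈log₂ (max {d, q + 1})⌉`. -/
def depthC4 (d q : ℕ) : ℕ := 8 + Nat.clog 2 (max d (q + 1))

/-- The width `C₅(d, q, M)`. -/
def widthC5 (d q M : ℕ) : ℕ :=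
  2 ^ d * (max (((d + q).choose d + d) * M ^ d * (2 + 2 * d) + d)
      (4 * (q + 1) * (d + q).choose d)
    + M ^ d * (2 * d + 2) + 12 * d)

/-- The parameter bound `C₆(d, M, h, B)`, with its constant factor `c₆` and the smoothness `p`. -/
noncomputable def boundC6 (c₆ p : ℝ) (d M : ℕ) (h B : ℝ) : ℝ :=
  c₆ * Real.exp (6 * 2 ^ (2 * (d + 1) + 1) * d * h) * (M : ℝ) ^ (10 * p + 2 * d + 10) * B ^ 12

/-!
Only the values of `F` on `[-1, 1]` matter, so the theorem is a statement about networks with one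
real input, composed with a feature whose values lie in `[-1, 1]`. As the constant may depend on
`C₁`, small `M` are covered by the zero function, and `M` may be taken as large as needed; all
factors that do not depend on `M` then disappear in the powers of `M` that the parameter bound
leaves unused, and `c₂ = c₃ = c₆ = 1` works.

**Approximant.** `F` has to be resolved at the scale `M⁻²` by layers of width `O(M)`. The interval
is cut into `M` coarse cells with `M` fine cells each, and a Taylor polynomial `P i j` of degree `q`
with bounded coefficients in powers of `x` is attached to each of the `M²` fine cells
(`HolderSmoothOn.exists_local_polynomial`). Differences of steep sigmoids form a partition of unity
`χ i (x)` over the coarse cells (`softCell`). The position inside the coarse cell is recorded by the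
zigzag coordinate, which runs alternately forwards and backwards and is therefore continuous across
coarse boundaries; a second partition of unity `ψ j` in this coordinate selects the fine cell. In a
transition zone of two coarse cells their zigzag coordinates almost agree, so `χ i * ψ j` is
negligible except close to the cell `(i, j)` (`softCell_mul_softCell_le_or`). Hence
`∑ i j, χ i * ψ j * P i j` is, up to negligible terms, a convex combination of good approximations,
and its error is `O(M ^ (-2 p))` (`abs_blended_sub_le`).

**Network.** Blocks of at most four neurons carry a value to the next layer or multiply two values,
the latter through second differences of the sigmoid function (`ApproxReads.gadget_id`,
`ApproxReads.gadget_mul`); with inputs scaled by `ε` their error is `O(ε)` and their readout weights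
are `O(ε⁻²)`. Four layers compute the `χ i`, the zigzag coordinate, the `ψ j` together with the
coefficients `∑ i, χ i * P i j`, and the coefficients of the blended polynomial. The matrix that
maps the `χ i` to the coefficients holds the `M² (q + 1)` data of `F`. The remaining
`4 + ⌈log₂ (q + 1)⌉` layers evaluate the polynomial by repeatedly halving its degree
(`exists_layers_folded`). With `ε = M ^ (-2 p - 3)` and steps of sharpness `M ^ 3` all errors are
`O(M ^ (-2 p))`, and all parameters are `O(M ^ (4 p + 10))`.
-/

/-! ### Hidden layers and approximate readouts -/

/-- `Reads B h r`: the function `r` is an affine combination of the neurons `h` whose weights and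
offset are at most `B` in absolute value. -/
def Reads {n : ℕ} (B : ℝ) (h : Fin n → ℝ → ℝ) (r : ℝ → ℝ) : Prop :=
  ∃ (w : Fin n → ℝ) (c : ℝ), (∀ i, |w i| ≤ B) ∧ |c| ≤ B ∧ ∀ x, r x = (∑ i, w i * h i x) + c

/-- `Hidden ι δ k h`: the neurons `h`, as functions of one real input, form the `k`-th layer of a
sigmoid network whose hidden layers have width `ι` and whose parameters are bounded by `δ`. The
input itself is layer `0`. -/
inductive Hidden (ι : ℕ) (δ : ℝ) : ℕ → {n : ℕ} → (Fin n → ℝ → ℝ) → Prop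
  | input : Hidden ι δ 0 (fun (_ : Fin 1) x => x)
  | step {k n : ℕ} {h : Fin n → ℝ → ℝ} {r : Fin ι → ℝ → ℝ} :
      Hidden ι δ k h → (∀ i, Reads δ h (r i)) →
        Hidden ι δ (k + 1) (fun i x => Real.sigmoid (r i x))

/-- A network acting on the `k`-th hidden layer is a network with `k` more layers acting on the
input. -/
lemma Hidden.exists_eval {ι k n : ℕ} {δ : ℝ} {h : Fin n → ℝ → ℝ} (H : Hidden ι δ k h) :
    ∀ (L N : ℕ), k + L = N → ∀ θ : DenseNet ι n L, θ.ParamBound δ →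
      ∃ θ' : DenseNet ι 1 N, θ'.ParamBound δ ∧
        ∀ x : ℝ, θ'.eval (fun _ => x) = θ.eval fun i => h i x := by
  induction H with
  | input =>
    intro L N hN θ hθ
    obtain rfl : L = N := by omega
    exact ⟨θ, hθ, fun x => rfl⟩
  | @step k n h r _ hr ih =>
    intro L N hN θ hθ
    choose w c hw hc hrw using hr
    obtain ⟨θ', h1, h2⟩ := ih (L + 1) N (by omega) (DenseNet.layer (Matrix.of w) c θ) ⟨hw, hc, hθ⟩
    refine ⟨θ', h1, fun x => ?_⟩
    rw [h2 x]
    simp only [DenseNet.eval, Matrix.of_apply, hrw]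

lemma Hidden.mem_netClass {ι k n : ℕ} {δ : ℝ} {h : Fin n → ℝ → ℝ} (H : Hidden ι δ k h)
    {r : ℝ → ℝ} (hr : Reads δ h r) : (fun y : Fin 1 → ℝ => r (y 0)) ∈ NetClass 1 k ι δ := by
  obtain ⟨w, c, hw, hc, hrw⟩ := hr
  obtain ⟨θ, h1, h2⟩ := H.exists_eval 0 k rfl (DenseNet.output w c) ⟨hw, hc⟩
  refine ⟨θ, h1, funext fun y => ?_⟩
  have hy : y = fun _ => y 0 := funext fun i => by rw [Subsingleton.elim i 0]
  conv_rhs => rw [hy]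
  rw [h2, hrw]
  rfl

namespace Reads

variable {n : ℕ} {B B' : ℝ} {h : Fin n → ℝ → ℝ} {r r' : ℝ → ℝ}

lemma mono (hr : Reads B h r) (hB : B ≤ B') : Reads B' h r := by
  obtain ⟨w, c, hw, hc, e⟩ := hr
  exact ⟨w, c, fun i => (hw i).trans hB, hc.trans hB, e⟩

lemma add (hr : Reads B h r) (hr' : Reads B' h r') : Reads (B + B') h fun x => r x + r' x := by
  obtain ⟨w, c, hw, hc, e⟩ := hr
  obtain ⟨w', c', hw', hc', e'⟩ := hr'
  refine ⟨fun i => w i + w' i, c + c', fun i => (abs_add_le _ _).trans (add_le_add (hw i) (hw' i)),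
    (abs_add_le _ _).trans (add_le_add hc hc'), fun x => ?_⟩
  simp only [e, e', add_mul, Finset.sum_add_distrib]
  ring

lemma const_mul (a : ℝ) (hr : Reads B h r) : Reads (|a| * B) h fun x => a * r x := by
  obtain ⟨w, c, hw, hc, e⟩ := hr
  refine ⟨fun i => a * w i, a * c, fun i => ?_, ?_, fun x => ?_⟩
  · rw [abs_mul]; exact mul_le_mul_of_nonneg_left (hw i) (abs_nonneg a)
  · rw [abs_mul]; exact mul_le_mul_of_nonneg_left hc (abs_nonneg a)
  · simp only [e, mul_add, Finset.mul_sum, mul_assoc]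

lemma const (h : Fin n → ℝ → ℝ) (c : ℝ) : Reads |c| h fun _ => c :=
  ⟨fun _ => 0, c, fun i => by simp, le_rfl, fun x => by simp⟩

lemma sum {S : Type} (s : Finset S) {r : S → ℝ → ℝ} (b : S → ℝ) (hr : ∀ i ∈ s, Reads (b i) h (r i)) :
    Reads (∑ i ∈ s, b i) h fun x => ∑ i ∈ s, r i x := by
  classical
  induction s using Finset.induction_on with
  | empty => simpa using const h 0
  | insert a s ha ih =>
    simp only [Finset.sum_insert ha]
    exact (hr a (Finset.mem_insert_self a s)).add
      (ih fun i hi => hr i (Finset.mem_insert_of_mem hi))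

end Reads

/-- `ApproxReads B η h v`: up to an error `η` on `[-1, 1]`, the function `v` is an affine
combination of the neurons `h` with coefficients bounded by `B`. -/
def ApproxReads {n : ℕ} (B η : ℝ) (h : Fin n → ℝ → ℝ) (v : ℝ → ℝ) : Prop :=
  ∃ r, Reads B h r ∧ ∀ x ∈ Set.Icc (-1 : ℝ) 1, |r x - v x| ≤ η

lemma Reads.approxReads {n : ℕ} {B : ℝ} {h : Fin n → ℝ → ℝ} {r : ℝ → ℝ} (hr : Reads B h r) :
    ApproxReads B 0 h r :=
  ⟨r, hr, fun x _ => by simp⟩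

namespace ApproxReads

variable {n : ℕ} {B B' η η' : ℝ} {h : Fin n → ℝ → ℝ} {v v' : ℝ → ℝ}

lemma mono (hv : ApproxReads B η h v) (hB : B ≤ B') (hη : η ≤ η') : ApproxReads B' η' h v := by
  obtain ⟨r, hr, e⟩ := hv
  exact ⟨r, hr.mono hB, fun x hx => (e x hx).trans hη⟩

lemma add (hv : ApproxReads B η h v) (hv' : ApproxReads B' η' h v') :
    ApproxReads (B + B') (η + η') h fun x => v x + v' x := by
  obtain ⟨r, hr, e⟩ := hv
  obtain ⟨r', hr', e'⟩ := hv'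
  refine ⟨_, hr.add hr', fun x hx => ?_⟩
  rw [add_sub_add_comm]
  exact (abs_add_le _ _).trans (add_le_add (e x hx) (e' x hx))

lemma const_mul (a : ℝ) (hv : ApproxReads B η h v) :
    ApproxReads (|a| * B) (|a| * η) h fun x => a * v x := by
  obtain ⟨r, hr, e⟩ := hv
  refine ⟨_, hr.const_mul a, fun x hx => ?_⟩
  rw [← mul_sub, abs_mul]
  exact mul_le_mul_of_nonneg_left (e x hx) (abs_nonneg a)

lemma sum {S : Type} (s : Finset S) {v : S → ℝ → ℝ} (b e : S → ℝ)
    (hv : ∀ i ∈ s, ApproxReads (b i) (e i) h (v i)) :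
    ApproxReads (∑ i ∈ s, b i) (∑ i ∈ s, e i) h fun x => ∑ i ∈ s, v i x := by
  have hv' : ∀ i, ∃ r, i ∈ s → Reads (b i) h r ∧
      ∀ x ∈ Set.Icc (-1 : ℝ) 1, |r x - v i x| ≤ e i := fun i => by
    by_cases hi : i ∈ s
    · obtain ⟨r, hr⟩ := hv i hi
      exact ⟨r, fun _ => hr⟩
    · exact ⟨0, fun hi' => absurd hi' hi⟩
  choose r hr using hv'
  refine ⟨_, Reads.sum s b fun i hi => (hr i hi).1, fun x hx => ?_⟩
  rw [← Finset.sum_sub_distrib]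
  exact (Finset.abs_sum_le_sum_abs _ _).trans (Finset.sum_le_sum fun i hi => (hr i hi).2 x hx)

end ApproxReads

/-! ### One layer of neurons from small blocks -/

/-- `Gadget δ B η h v`: a block of four sigmoid neurons, whose inputs are affine combinations of
the neurons `h` with coefficients bounded by `δ`, yields `v` up to an error `η` on `[-1, 1]`
through an affine readout with coefficients bounded by `B`. -/
def Gadget {n : ℕ} (δ B η : ℝ) (h : Fin n → ℝ → ℝ) (v : ℝ → ℝ) : Prop :=
  ∃ (r : Fin 4 → ℝ → ℝ) (w : Fin 4 → ℝ) (c : ℝ),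
    (∀ i, Reads δ h (r i)) ∧ (∀ i, |w i| ≤ B) ∧ |c| ≤ B ∧
      ∀ x ∈ Set.Icc (-1 : ℝ) 1, |(∑ i, w i * Real.sigmoid (r i x)) + c - v x| ≤ η

lemma Gadget.mono {n : ℕ} {δ B B' η η' : ℝ} {h : Fin n → ℝ → ℝ} {v : ℝ → ℝ}
    (hv : Gadget δ B η h v) (hB : B ≤ B') (hη : η ≤ η') : Gadget δ B' η' h v := by
  obtain ⟨r, w, c, hr, hw, hc, e⟩ := hv
  exact ⟨r, w, c, hr, fun i => (hw i).trans hB, hc.trans hB, fun x hx => (e x hx).trans hη⟩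

/-- Blocks computing the functions `v s` can be placed side by side in one layer, as long as the
width allows it; the neurons that remain receive zero weights. -/
lemma Hidden.exists_layer {ι k n : ℕ} {δ B η : ℝ} {h : Fin n → ℝ → ℝ} (H : Hidden ι δ k h)
    (hδ : 0 ≤ δ) (hB : 0 ≤ B) {S : Type} [Fintype S] {v : S → ℝ → ℝ}
    (hv : ∀ s, Gadget δ B η h (v s)) (hι : 4 * Fintype.card S ≤ ι) :
    ∃ h' : Fin ι → ℝ → ℝ, Hidden ι δ (k + 1) h' ∧ ∀ s, ApproxReads B η h' (v s) := by
  classical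
  choose r w c hr hw hc e using hv
  have hcard : Fintype.card (S × Fin 4) ≤ Fintype.card (Fin ι) := by
    simp only [Fintype.card_prod, Fintype.card_fin]; omega
  obtain ⟨f⟩ := Function.Embedding.nonempty_of_card_le hcard
  -- Neurons outside the range of `f` get the zero function as input.
  let R : Fin ι → ℝ → ℝ := Function.extend f (fun p => r p.1 p.2) 0
  have hR : ∀ i, Reads δ h (R i) := by
    intro i
    by_cases hi : ∃ p, f p = i
    · obtain ⟨p, rfl⟩ := hi
      simpa only [R, f.injective.extend_apply] using hr p.1 p.2
    · simp only [R, Function.extend_apply' _ _ _ hi]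
      exact (Reads.const h 0).mono (by simpa using hδ)
  refine ⟨_, Hidden.step H hR, fun s => ?_⟩
  refine ⟨_, ⟨Function.extend f (fun p => if p.1 = s then w s p.2 else 0) 0, c s, ?_, hc s,
    fun x => rfl⟩, fun x hx => ?_⟩
  · intro i
    by_cases hi : ∃ p, f p = i
    · obtain ⟨p, rfl⟩ := hi
      rw [f.injective.extend_apply]
      split_ifs
      · exact hw s p.2
      · simpa using hB
    · rw [Function.extend_apply' _ _ _ hi]
      simpa using hB
  · convert e s x hx using 4
    rw [← Finset.sum_subset (Finset.subset_univ (Finset.univ.map f))]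
    · rw [Finset.sum_map]
      simp only [f.injective.extend_apply, R]
      rw [Fintype.sum_prod_type, Finset.sum_eq_single s]
      · simp
      · intro b _ hb
        simp [hb]
      · simp
    · intro i _ hi
      rw [Function.extend_apply' _ _ _ (by simpa using hi)]
      simp

/-! ### Identity, product and step blocks -/

lemma abs_sigmoid_sub_linear_le {t : ℝ} (ht : |t| ≤ 1) :
    |Real.sigmoid t - 1 / 2 - t / 4| ≤ t ^ 2 := by
  have hE := Real.abs_exp_sub_one_sub_id_le (x := -t) (by rwa [abs_neg])
  have hpos := Real.exp_pos (-t)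
  rw [Real.sigmoid_def]
  set E := Real.exp (-t)
  have h1 : (1 + E)⁻¹ - 1 / 2 - t / 4 = (2 * (1 - E) - t * (1 + E)) / (4 * (1 + E)) := by
    field_simp; ring
  rw [h1, abs_div, abs_of_pos (by positivity : (0 : ℝ) < 4 * (1 + E)), div_le_iff₀ (by positivity)]
  obtain ⟨R, hR⟩ : ∃ R, R = E - 1 - -t := ⟨_, rfl⟩
  rw [← hR] at hE
  have h2 : 2 * (1 - E) - t * (1 + E) = t ^ 2 - 2 * R - t * R := by rw [hR]; ring
  have h3 : |t * R| ≤ 1 * t ^ 2 := by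
    rw [abs_mul]; exact mul_le_mul ht (by simpa using hE) (abs_nonneg _) zero_le_one
  have h4 : |t ^ 2 - 2 * R - t * R| ≤ 4 * t ^ 2 := by
    rw [abs_le] at *
    constructor <;> nlinarith [sq_nonneg t]
  rw [h2]
  nlinarith [mul_nonneg (sq_nonneg t) hpos.le]

lemma abs_cosh_sub_quadratic_le {t : ℝ} (ht : |t| ≤ 1) :
    |Real.cosh t - 1 - t ^ 2 / 2| ≤ t ^ 4 := by
  have h1 := Real.exp_bound ht (n := 4) (by norm_num)
  have h2 := Real.exp_bound (x := -t) (by rwa [abs_neg]) (n := 4) (by norm_num)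
  have h3 : |t| ^ 4 = t ^ 4 := by
    rw [show (4 : ℕ) = 2 * 2 from rfl, pow_mul, pow_mul, sq_abs]
  rw [abs_neg, h3] at h2
  rw [h3] at h1
  simp only [Finset.sum_range_succ, Finset.sum_range_zero, Nat.factorial] at h1 h2
  norm_num at h1 h2
  rw [Real.cosh_eq]
  rw [abs_le] at *
  have : 0 ≤ t ^ 4 := by positivity
  constructor <;> nlinarith

/-- Second differences of the sigmoid function at `-log 2`, a point where its second derivative
does not vanish, are squares up to fourth order. -/
lemma abs_sigmoid_second_difference_le {t : ℝ} (ht : |t| ≤ 1) :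
    |Real.sigmoid (-Real.log 2 + t) + Real.sigmoid (-Real.log 2 - t) - 2 / 3 - 2 / 27 * t ^ 2|
      ≤ t ^ 4 := by
  have hE : ∀ u : ℝ, Real.sigmoid (-Real.log 2 + u) = (1 + 2 * Real.exp (-u))⁻¹ := fun u => by
    rw [Real.sigmoid_def, show -(-Real.log 2 + u) = Real.log 2 + -u by ring, Real.exp_add,
      Real.exp_log (by norm_num)]
  have hc := abs_cosh_sub_quadratic_le ht
  have hc1 := Real.one_le_cosh t
  have hmul : Real.exp t * Real.exp (-t) = 1 := by rw [← Real.exp_add]; simp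
  have hsum : Real.exp t + Real.exp (-t) = 2 * Real.cosh t := by rw [Real.cosh_eq]; ring
  have hE1 := Real.exp_pos t
  have hE2 := Real.exp_pos (-t)
  rw [sub_eq_add_neg (-Real.log 2) t, hE, hE, neg_neg]
  set a := Real.exp t
  set b := Real.exp (-t)
  set c := Real.cosh t
  obtain ⟨R, hR⟩ : ∃ R, R = c - 1 - t ^ 2 / 2 := ⟨_, rfl⟩
  rw [← hR] at hc
  have h1 : (1 + 2 * b)⁻¹ + (1 + 2 * a)⁻¹ = (2 + 4 * c) / (5 + 4 * c) := by
    rw [inv_add_inv (by positivity) (by positivity)]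
    congr 1
    · linear_combination 2 * hsum
    · linear_combination 2 * hsum + 4 * hmul
  have h2 : (2 + 4 * c) / (5 + 4 * c) - 2 / 3 - 2 / 27 * t ^ 2
      = (36 * R - 8 * t ^ 2 * (t ^ 2 / 2 + R)) / (27 * (5 + 4 * c)) := by
    have : (5 + 4 * c) ≠ 0 := by positivity
    have hc' : c = 1 + t ^ 2 / 2 + R := by rw [hR]; ring
    field_simp
    rw [hc']
    ring
  have ht2 : t ^ 2 ≤ 1 := by rw [← sq_abs]; exact pow_le_one₀ (abs_nonneg t) ht
  have h3 : |t ^ 2 * R| ≤ 1 * t ^ 4 := by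
    rw [abs_mul, abs_of_nonneg (sq_nonneg t)]
    exact mul_le_mul ht2 hc (abs_nonneg _) zero_le_one
  have ht4 : 0 ≤ t ^ 4 := by positivity
  rw [h1, h2, abs_div, abs_of_pos (by positivity : (0 : ℝ) < 27 * (5 + 4 * c)),
    div_le_iff₀ (by positivity)]
  have h4 : |36 * R - 8 * t ^ 2 * (t ^ 2 / 2 + R)| ≤ 48 * t ^ 4 := by
    rw [abs_le] at *
    constructor <;> nlinarith
  nlinarith [mul_nonneg ht4 (sub_nonneg.2 hc1)]

/-- The identity block `(4 / ε) (σ (ε v) - 1 / 2)` carries a bounded function to the next layer. -/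
lemma ApproxReads.gadget_id {n : ℕ} {δ B η ε K : ℝ} {h : Fin n → ℝ → ℝ} {v : ℝ → ℝ}
    (hv : ApproxReads B η h v) (hK : 1 ≤ K) (hvK : ∀ x ∈ Set.Icc (-1 : ℝ) 1, |v x| ≤ K)
    (hε : 0 < ε) (hεK : 4 * K * ε ≤ 1) (hη : 0 ≤ η) (hη1 : η ≤ 1) (hB : 0 ≤ B)
    (hδ : 2 * ε * B + 1 ≤ δ) : Gadget δ (4 / ε ^ 2) (2000 * K ^ 4 * (ε + η)) h v := by
  obtain ⟨r, hr, e⟩ := hv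
  have hε1 : ε ≤ 1 := by nlinarith
  have hεB : 0 ≤ ε * B := by positivity
  have hle : 4 / ε ≤ 4 / ε ^ 2 := by
    apply div_le_div_of_nonneg_left (by norm_num) (by positivity)
    nlinarith
  have h0 : 0 ≤ 4 / ε ^ 2 := by positivity
  refine ⟨fun _ x => ε * r x, ![4 / ε, 0, 0, 0], -(2 / ε), fun i => (hr.const_mul ε).mono ?_,
    fun i => ?_, ?_, fun x hx => ?_⟩
  · rw [abs_of_pos hε]; linarith
  · fin_cases i
    · exact (abs_of_pos (by positivity : 0 < 4 / ε)).trans_le hle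
    all_goals simpa using h0
  · rw [abs_neg, abs_of_pos (by positivity)]
    exact le_trans (by gcongr; norm_num) hle
  · have hrx : |r x| ≤ 2 * K := by
      have h1 := abs_sub_abs_le_abs_sub (r x) (v x)
      linarith [e x hx, hvK x hx]
    have hs : |ε * r x| ≤ 1 := by
      rw [abs_mul, abs_of_pos hε]
      nlinarith [mul_le_mul_of_nonneg_left hrx hε.le]
    have h1 := abs_sigmoid_sub_linear_le hs
    have h2 : |4 / ε * (Real.sigmoid (ε * r x) - 1 / 2 - ε * r x / 4)|
        ≤ 4 / ε * (ε * r x) ^ 2 := by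
      rw [abs_mul, abs_of_pos (by positivity : 0 < 4 / ε)]
      gcongr
    have h3 : 4 / ε * (ε * r x) ^ 2 = 4 * ε * (r x) ^ 2 := by field_simp
    have h4 : (r x) ^ 2 ≤ 4 * K ^ 2 := by
      rw [← sq_abs]; nlinarith [abs_nonneg (r x)]
    have h5 : K ^ 2 ≤ K ^ 4 := pow_le_pow_right₀ hK (by norm_num)
    have h6 : 1 ≤ K ^ 4 := one_le_pow₀ hK
    have h7 : 4 / ε * Real.sigmoid (ε * r x) + -(2 / ε) - v x
        = 4 / ε * (Real.sigmoid (ε * r x) - 1 / 2 - ε * r x / 4) + (r x - v x) := by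
      field_simp; ring
    simp only [Fin.sum_univ_four, Matrix.cons_val, zero_mul, add_zero]
    rw [h7]
    have h8 : 4 * ε * (r x) ^ 2 ≤ 16 * K ^ 4 * ε := by nlinarith
    have h9 : η ≤ K ^ 4 * η := by nlinarith
    have h10 : 0 ≤ K ^ 4 * ε := by positivity
    calc _ ≤ 4 * ε * (r x) ^ 2 + η :=
          (abs_add_le _ _).trans (add_le_add (h2.trans_eq h3) (e x hx))
      _ ≤ 2000 * K ^ 4 * (ε + η) := by nlinarith

/-- The product block: `x y = ((x + y)² - (x - y)²) / 4`, with each square replaced by a second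
difference of the sigmoid function. -/
lemma ApproxReads.gadget_mul {n : ℕ} {δ B η ε K : ℝ} {h : Fin n → ℝ → ℝ} {u v : ℝ → ℝ}
    (hu : ApproxReads B η h u) (hv : ApproxReads B η h v) (hK : 1 ≤ K)
    (huK : ∀ x ∈ Set.Icc (-1 : ℝ) 1, |u x| ≤ K) (hvK : ∀ x ∈ Set.Icc (-1 : ℝ) 1, |v x| ≤ K)
    (hε : 0 < ε) (hεK : 4 * K * ε ≤ 1) (hη : 0 ≤ η) (hη1 : η ≤ 1) (hB : 0 ≤ B)
    (hδ : 2 * ε * B + 1 ≤ δ) :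
    Gadget δ (4 / ε ^ 2) (2000 * K ^ 4 * (ε + η)) h fun x => u x * v x := by
  obtain ⟨r, hr, e⟩ := hu
  obtain ⟨r', hr', e'⟩ := hv
  have hε1 : ε ≤ 1 := by nlinarith
  have hεB : 0 ≤ ε * B := by positivity
  have hlog : |-Real.log 2| ≤ 1 := by
    rw [abs_neg, abs_of_pos (Real.log_pos (by norm_num))]
    linarith [Real.log_two_lt_d9]
  have key : ∀ a b : ℝ, |a| = ε → |b| = ε →
      Reads δ h fun x => -Real.log 2 + (a * r x + b * r' x) := fun a b ha hb => by
    refine ((Reads.const h (-Real.log 2)).add ((hr.const_mul a).add (hr'.const_mul b))).mono ?_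
    rw [ha, hb]; linarith
  have ha : |ε| = ε := abs_of_pos hε
  have hna : |-ε| = ε := by rw [abs_neg, ha]
  have h0 : (0 : ℝ) ≤ 4 / ε ^ 2 := by positivity
  have hw : |27 / 8 / ε ^ 2| ≤ 4 / ε ^ 2 := by
    rw [abs_of_pos (by positivity)]; gcongr; norm_num
  refine ⟨![fun x => -Real.log 2 + (ε * r x + ε * r' x), fun x => -Real.log 2 + (-ε * r x + -ε * r' x),
      fun x => -Real.log 2 + (ε * r x + -ε * r' x), fun x => -Real.log 2 + (-ε * r x + ε * r' x)],
    ![27 / 8 / ε ^ 2, 27 / 8 / ε ^ 2, -(27 / 8 / ε ^ 2), -(27 / 8 / ε ^ 2)], 0, fun i => ?_,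
    fun i => ?_, by simpa using h0, fun x hx => ?_⟩
  · fin_cases i
    · exact key _ _ ha ha
    · exact key _ _ hna hna
    · exact key _ _ ha hna
    · exact key _ _ hna ha
  · fin_cases i
    · exact hw
    · exact hw
    · exact (abs_neg _).trans_le hw
    · exact (abs_neg _).trans_le hw
  · have hrx : |r x| ≤ 2 * K := by
      have h1 := abs_sub_abs_le_abs_sub (r x) (u x)
      linarith [e x hx, huK x hx]
    have hrx' : |r' x| ≤ 2 * K := by
      have h1 := abs_sub_abs_le_abs_sub (r' x) (v x)
      linarith [e' x hx, hvK x hx]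
    have sq : ∀ z : ℝ, |z| ≤ 4 * K →
        |27 / 8 / ε ^ 2 * (Real.sigmoid (-Real.log 2 + ε * z) + Real.sigmoid (-Real.log 2 - ε * z)
          - 2 / 3 - 2 / 27 * (ε * z) ^ 2)| ≤ 864 * K ^ 4 * ε := fun z hz => by
      have hz1 : |ε * z| ≤ 1 := by
        rw [abs_mul, ha]
        nlinarith [mul_le_mul_of_nonneg_left hz hε.le]
      have h1 := abs_sigmoid_second_difference_le hz1
      rw [abs_mul, abs_of_pos (by positivity : 0 < 27 / 8 / ε ^ 2)]
      have hz4 : z ^ 4 ≤ (4 * K) ^ 4 := by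
        have : |z| ^ 4 = z ^ 4 := by
          rw [show (4 : ℕ) = 2 * 2 from rfl, pow_mul, pow_mul, sq_abs]
        rw [← this]
        exact pow_le_pow_left₀ (abs_nonneg z) hz 4
      calc _ ≤ 27 / 8 / ε ^ 2 * (ε * z) ^ 4 := by gcongr
        _ = 27 / 8 * ε ^ 2 * z ^ 4 := by field_simp
        _ ≤ 27 / 8 * ε ^ 2 * (4 * K) ^ 4 := by gcongr
        _ = 864 * K ^ 4 * ε * ε := by ring
        _ ≤ 864 * K ^ 4 * ε * 1 := by gcongr
        _ = _ := by ring
    have s1 := sq (r x + r' x) ((abs_add_le _ _).trans (by linarith))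
    have s2 := sq (r x - r' x) ((abs_sub _ _).trans (by linarith))
    have h3 : |r x * r' x - u x * v x| ≤ 3 * K * η := by
      have : r x * r' x - u x * v x = r x * (r' x - v x) + (r x - u x) * v x := by ring
      rw [this]
      refine (abs_add_le _ _).trans ?_
      rw [abs_mul, abs_mul]
      have := mul_le_mul hrx (e' x hx) (abs_nonneg _) (by positivity)
      have := mul_le_mul (e x hx) (hvK x hx) (abs_nonneg _) hη
      nlinarith
    have h4 : K ≤ K ^ 4 := by simpa using pow_le_pow_right₀ hK (show 1 ≤ 4 by norm_num)
    have h5 : K * η ≤ K ^ 4 * η := by gcongr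
    have h6 : 0 ≤ K ^ 4 * ε := by positivity
    have h7 : 0 ≤ K ^ 4 * η := by positivity
    simp only [Fin.sum_univ_four, Matrix.cons_val, add_zero]
    rw [show -Real.log 2 + (ε * r x + ε * r' x) = -Real.log 2 + ε * (r x + r' x) by ring,
      show -Real.log 2 + (-ε * r x + -ε * r' x) = -Real.log 2 - ε * (r x + r' x) by ring,
      show -Real.log 2 + (ε * r x + -ε * r' x) = -Real.log 2 + ε * (r x - r' x) by ring,
      show -Real.log 2 + (-ε * r x + ε * r' x) = -Real.log 2 - ε * (r x - r' x) by ring]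
    generalize Real.sigmoid (-Real.log 2 + ε * (r x + r' x)) = A1 at *
    generalize Real.sigmoid (-Real.log 2 - ε * (r x + r' x)) = A2 at *
    generalize Real.sigmoid (-Real.log 2 + ε * (r x - r' x)) = A3 at *
    generalize Real.sigmoid (-Real.log 2 - ε * (r x - r' x)) = A4 at *
    have h8 : 27 / 8 / ε ^ 2 * A1 + 27 / 8 / ε ^ 2 * A2 + -(27 / 8 / ε ^ 2) * A3
        + -(27 / 8 / ε ^ 2) * A4 - u x * v x
        = 27 / 8 / ε ^ 2 * (A1 + A2 - 2 / 3 - 2 / 27 * (ε * (r x + r' x)) ^ 2)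
          - 27 / 8 / ε ^ 2 * (A3 + A4 - 2 / 3 - 2 / 27 * (ε * (r x - r' x)) ^ 2)
          + (r x * r' x - u x * v x) := by
      field_simp; ring
    rw [h8]
    refine (abs_add_le _ _).trans ?_
    have := abs_sub (27 / 8 / ε ^ 2 * (A1 + A2 - 2 / 3 - 2 / 27 * (ε * (r x + r' x)) ^ 2))
      (27 / 8 / ε ^ 2 * (A3 + A4 - 2 / 3 - 2 / 27 * (ε * (r x - r' x)) ^ 2))
    nlinarith

/-! ### Soft partitions into cells -/

/-- The soft indicator, of sharpness `κ`, of the half-line to the right of the `j`-th point of the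
grid `a, a + w, …, a + N w`. The first and the last step are replaced by the constants `1` and `0`,
so that the cells below form an exact partition of unity on the whole line. -/
noncomputable def softStep (κ a w : ℝ) (N j : ℕ) (v : ℝ) : ℝ :=
  if j = 0 then 1 else if N ≤ j then 0 else Real.sigmoid (κ * (v - (a + j * w)))

/-- The soft indicator of the `j`-th cell `[a + j w, a + (j + 1) w]` of a grid with `N` cells. -/
noncomputable def softCell (κ a w : ℝ) (N j : ℕ) (v : ℝ) : ℝ :=
  softStep κ a w N j v - softStep κ a w N (j + 1) v

section SoftCell

variable {κ a w : ℝ} {N : ℕ}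

lemma softStep_nonneg (j : ℕ) (v : ℝ) : 0 ≤ softStep κ a w N j v := by
  unfold softStep
  split_ifs
  exacts [zero_le_one, le_rfl, Real.sigmoid_nonneg _]

lemma softStep_le_one (j : ℕ) (v : ℝ) : softStep κ a w N j v ≤ 1 := by
  unfold softStep
  split_ifs
  exacts [le_rfl, zero_le_one, Real.sigmoid_le_one _]

lemma softStep_succ_le (hκ : 0 ≤ κ) (hw : 0 ≤ w) (j : ℕ) (v : ℝ) :
    softStep κ a w N (j + 1) v ≤ softStep κ a w N j v := by
  by_cases hj : j = 0
  · rw [show softStep κ a w N j v = 1 by simp [softStep, hj]]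
    exact softStep_le_one _ _
  by_cases hN : N ≤ j + 1
  · rw [show softStep κ a w N (j + 1) v = 0 by simp [softStep, hN]]
    exact softStep_nonneg _ _
  · have hN' : ¬ N ≤ j := by omega
    simp only [softStep, hj, hN, hN', if_false, Nat.add_eq_zero_iff, one_ne_zero, and_false]
    apply Real.sigmoid_le
    push_cast
    gcongr
    linarith

lemma softCell_nonneg (hκ : 0 ≤ κ) (hw : 0 ≤ w) (j : ℕ) (v : ℝ) : 0 ≤ softCell κ a w N j v :=
  sub_nonneg.2 (softStep_succ_le hκ hw j v)

lemma softCell_le_one (j : ℕ) (v : ℝ) : softCell κ a w N j v ≤ 1 := by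
  have := softStep_le_one (κ := κ) (a := a) (w := w) (N := N) j v
  have := softStep_nonneg (κ := κ) (a := a) (w := w) (N := N) (j + 1) v
  unfold softCell
  linarith

lemma sum_softCell (hN : N ≠ 0) (v : ℝ) : ∑ j ∈ Finset.range N, softCell κ a w N j v = 1 := by
  unfold softCell
  rw [Finset.sum_range_sub']
  simp [softStep, hN]

lemma sigmoid_neg_le_exp (t : ℝ) : Real.sigmoid (-t) ≤ Real.exp (-t) := by
  rw [← Real.sigmoid_mul_rexp_neg]
  exact mul_le_of_le_one_left (Real.exp_pos _).le (Real.sigmoid_le_one _)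

/-- Away from its cell, a soft indicator is exponentially small. -/
lemma softCell_le_exp_or_mem (hκ : 0 ≤ κ) {j : ℕ} (hj : j < N) {v r : ℝ}
    (h0 : a - r ≤ v) (h1 : v ≤ a + N * w + r) :
    softCell κ a w N j v ≤ Real.exp (-(κ * r)) ∨
      (a + j * w - r ≤ v ∧ v ≤ a + (j + 1) * w + r) := by
  by_cases hl : a + j * w - r ≤ v
  · by_cases hu : v ≤ a + (j + 1) * w + r
    · exact Or.inr ⟨hl, hu⟩
    · left
      rw [not_le] at hu
      have hN : j + 1 ≠ N := by
        rintro rfl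
        push_cast at h1
        linarith
      have hN' : ¬ N ≤ j + 1 := by omega
      have h2 : softStep κ a w N (j + 1) v = 1 - Real.sigmoid (-(κ * (v - (a + (j + 1) * w)))) := by
        rw [Real.sigmoid_neg]
        simp [softStep, hN']
      have h3 := softStep_le_one (κ := κ) (a := a) (w := w) (N := N) j v
      have h4 : Real.sigmoid (-(κ * (v - (a + (j + 1) * w)))) ≤ Real.sigmoid (-(κ * r)) := by
        apply Real.sigmoid_le
        have : r ≤ v - (a + (j + 1) * w) := by linarith
        nlinarith
      have h5 := sigmoid_neg_le_exp (κ * r)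
      unfold softCell
      linarith
  · left
    rw [not_le] at hl
    have hj0 : j ≠ 0 := by
      rintro rfl
      simp at hl
      linarith
    have h2 : softStep κ a w N j v = Real.sigmoid (κ * (v - (a + j * w))) := by
      simp [softStep, hj0, hj]
    have h3 := softStep_nonneg (κ := κ) (a := a) (w := w) (N := N) (j + 1) v
    have h4 : Real.sigmoid (κ * (v - (a + j * w))) ≤ Real.sigmoid (-(κ * r)) := by
      apply Real.sigmoid_le
      have : v - (a + j * w) ≤ -r := by linarith
      nlinarith
    have h5 := sigmoid_neg_le_exp (κ * r)
    unfold softCell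
    linarith

/-- A soft indicator of an exactly available function is computed without error by two neurons. -/
lemma Reads.gadget_softCell {n : ℕ} {δ B : ℝ} {h : Fin n → ℝ → ℝ} {r : ℝ → ℝ} (hr : Reads B h r)
    (hκ : 0 ≤ κ) (hw : 0 ≤ w) {j : ℕ} (hj : j < N) (hδ : κ * (B + |a| + N * w) ≤ δ) :
    Gadget δ 1 0 h fun x => softCell κ a w N j (r x) := by
  have key : ∀ i : ℕ, i ≤ N → Reads δ h fun x => κ * (r x + -(a + i * w)) := fun i hi => by
    refine ((hr.add (Reads.const h (-(a + i * w)))).const_mul κ).mono ?_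
    rw [abs_of_nonneg hκ, abs_neg]
    refine le_trans (mul_le_mul_of_nonneg_left ?_ hκ) hδ
    have h1 := abs_add_le a (i * w)
    rw [abs_of_nonneg (by positivity : 0 ≤ (i : ℝ) * w)] at h1
    have h2 : (i : ℝ) * w ≤ N * w := by gcongr
    linarith
  have step : ∀ i : ℕ, ∃ b c : ℝ, |b| ≤ 1 ∧ (c = if i = 0 then 1 else 0) ∧
      ∀ v, softStep κ a w N i v = b * Real.sigmoid (κ * (v + -(a + i * w))) + c := fun i => by
    by_cases hi : i = 0
    · exact ⟨0, 1, by simp, by simp [hi], fun v => by simp [softStep, hi]⟩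
    by_cases hN : N ≤ i
    · exact ⟨0, 0, by simp, by simp [hi], fun v => by simp [softStep, hi, hN]⟩
    · exact ⟨1, 0, by simp, by simp [hi], fun v => by simp [softStep, hi, hN, sub_eq_add_neg]⟩
  obtain ⟨b, c, hb, hc, e⟩ := step j
  obtain ⟨b', c', hb', hc', e'⟩ := step (j + 1)
  rw [if_neg (Nat.succ_ne_zero j)] at hc'
  refine ⟨![fun x => κ * (r x + -(a + j * w)), fun x => κ * (r x + -(a + (j + 1 : ℕ) * w)),
    fun x => κ * (r x + -(a + j * w)), fun x => κ * (r x + -(a + j * w))], ![b, -b', 0, 0], c,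
    fun i => ?_, fun i => ?_, ?_, fun x _ => ?_⟩
  · fin_cases i
    · exact key j hj.le
    · exact key (j + 1) hj
    · exact key j hj.le
    · exact key j hj.le
  · fin_cases i
    · exact hb
    · exact (abs_neg _).trans_le hb'
    all_goals simp
  · rw [hc]
    split_ifs <;> simp
  · simp only [Fin.sum_univ_four, Matrix.cons_val, zero_mul, add_zero, softCell, e, e', hc']
    rw [show ∀ A C D : ℝ, A + -b' * C + D - (A + D - b' * C) = 0 by intros; ring]
    simp

end SoftCell

/-- A convex combination of values that are close to `c`, except for those of negligible weight,
is close to `c`. -/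
lemma abs_sum_mul_sub_le {S : Type} (s : Finset S) {l f : S → ℝ} {c R D τ : ℝ}
    (hl : ∀ i ∈ s, 0 ≤ l i) (hl1 : ∑ i ∈ s, l i = 1) (hR : 0 ≤ R) (hτ : 0 ≤ τ)
    (hD : ∀ i ∈ s, |f i - c| ≤ D) (hf : ∀ i ∈ s, l i ≤ τ ∨ |f i - c| ≤ R) :
    |(∑ i ∈ s, l i * f i) - c| ≤ R + s.card * (τ * D) := by
  have h1 : (∑ i ∈ s, l i * f i) - c = ∑ i ∈ s, l i * (f i - c) := by
    simp only [mul_sub, Finset.sum_sub_distrib]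
    rw [← Finset.sum_mul, hl1, one_mul]
  rw [h1]
  calc |∑ i ∈ s, l i * (f i - c)| ≤ ∑ i ∈ s, |l i * (f i - c)| := Finset.abs_sum_le_sum_abs _ _
    _ ≤ ∑ i ∈ s, (l i * R + τ * D) := by
        refine Finset.sum_le_sum fun i hi => ?_
        have hli := hl i hi
        have hDi := hD i hi
        have hD0 : 0 ≤ D := (abs_nonneg _).trans hDi
        rw [abs_mul, abs_of_nonneg hli]
        rcases hf i hi with h | h
        · have := mul_le_mul h hDi (abs_nonneg _) hτ
          nlinarith [mul_nonneg hli hR]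
        · have := mul_le_mul_of_nonneg_left h hli
          nlinarith [mul_nonneg hτ hD0]
    _ = R + s.card * (τ * D) := by
        rw [Finset.sum_add_distrib, ← Finset.sum_mul, hl1, Finset.sum_const, nsmul_eq_mul, one_mul]

/-! ### Local polynomial approximation of Hölder smooth functions -/

/-- Taylor's estimate, simultaneously for all derivatives: the remainder of the `j`-th derivative is
bounded by integrating that of the next derivative along the segment from `z` to `x`, starting from
the Hölder bound on the derivative of order `q`. -/
lemma HolderSmoothOn.abs_sub_taylor_le {q : ℕ} {s C₀ a b : ℝ} {F : ℝ → ℝ} (hs : 0 < s)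
    (hC₀ : 0 ≤ C₀) (hF : HolderSmoothOn q s C₀ F (Set.Icc a b)) {z : ℝ} (hz : z ∈ Set.Icc a b) :
    ∀ n j : ℕ, j + n = q → ∀ x ∈ Set.Icc a b,
      |iteratedDerivWithin j F (Set.Icc a b) x - ∑ m ∈ Finset.range (n + 1),
        iteratedDerivWithin (j + m) F (Set.Icc a b) z * ((x - z) ^ m / m.factorial)|
        ≤ C₀ * |x - z| ^ (n + s) := by
  intro n
  induction n with
  | zero =>
    rintro j rfl x hx
    simpa using hF.2 x hx z hz
  | succ n ih =>
    intro j hj x hx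
    have hsub : Set.uIcc z x ⊆ Set.Icc a b := Set.uIcc_subset_Icc hz hx
    have hderiv : ∀ y ∈ Set.uIcc z x, HasDerivWithinAt
        (fun y => iteratedDerivWithin j F (Set.Icc a b) y - ∑ m ∈ Finset.range (n + 1 + 1),
          iteratedDerivWithin (j + m) F (Set.Icc a b) z * ((y - z) ^ m / m.factorial))
        (iteratedDerivWithin (j + 1) F (Set.Icc a b) y - ∑ m ∈ Finset.range (n + 1),
          iteratedDerivWithin (j + 1 + m) F (Set.Icc a b) z * ((y - z) ^ m / m.factorial))
        (Set.uIcc z x) y := by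
      intro y hy
      have h1 : HasDerivWithinAt (iteratedDerivWithin j F (Set.Icc a b))
          (iteratedDerivWithin (j + 1) F (Set.Icc a b) y) (Set.uIcc z x) y := by
        rw [iteratedDerivWithin_succ]
        exact ((hF.1 j (by omega)) y (hsub hy)).hasDerivWithinAt.mono hsub
      have h2 : HasDerivAt (fun y => ∑ m ∈ Finset.range (n + 1 + 1),
          iteratedDerivWithin (j + m) F (Set.Icc a b) z * ((y - z) ^ m / m.factorial))
          (∑ m ∈ Finset.range (n + 1 + 1), iteratedDerivWithin (j + m) F (Set.Icc a b) z *
            (m * (y - z) ^ (m - 1) * 1 / m.factorial)) y :=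
        HasDerivAt.fun_sum fun m _ =>
          (((((hasDerivAt_id y).sub_const z).pow m).div_const _).const_mul _)
      rw [Finset.sum_range_succ'] at h2
      simp only [Nat.cast_zero, zero_mul, zero_div, mul_zero, add_zero] at h2
      refine (h1.fun_sub h2.hasDerivWithinAt).congr_deriv ?_
      congr 1
      refine Finset.sum_congr rfl fun m _ => ?_
      rw [show j + (m + 1) = j + 1 + m by ring, Nat.add_sub_cancel, Nat.factorial_succ]
      have : (m.factorial : ℝ) ≠ 0 := by positivity
      push_cast
      field_simp
    have hbound : ∀ y ∈ Set.uIcc z x,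
        ‖iteratedDerivWithin (j + 1) F (Set.Icc a b) y - ∑ m ∈ Finset.range (n + 1),
          iteratedDerivWithin (j + 1 + m) F (Set.Icc a b) z * ((y - z) ^ m / m.factorial)‖
          ≤ C₀ * |x - z| ^ (n + s) := by
      intro y hy
      refine (ih (j + 1) (by omega) y (hsub hy)).trans ?_
      have : |y - z| ≤ |x - z| := Set.abs_sub_left_of_mem_uIcc hy
      gcongr
    have := Convex.norm_image_sub_le_of_norm_hasDerivWithin_le hderiv hbound (convex_uIcc z x)
      Set.left_mem_uIcc Set.right_mem_uIcc
    have hz0 : iteratedDerivWithin j F (Set.Icc a b) z - ∑ m ∈ Finset.range (n + 1 + 1),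
          iteratedDerivWithin (j + m) F (Set.Icc a b) z * ((z - z) ^ m / m.factorial) = 0 := by
      rw [Finset.sum_range_succ']
      simp
    simp only [hz0, sub_zero, Real.norm_eq_abs] at this
    refine this.trans_eq ?_
    rw [mul_assoc, ← Real.rpow_add_one' (abs_nonneg _) (by positivity)]
    push_cast
    congr 2
    ring

/-- The Taylor polynomial at a point of `[-1, 1]`, in powers of `x` itself: its coefficients are
bounded independently of the expansion point. -/
lemma HolderSmoothOn.exists_local_polynomial {q : ℕ} {s C₀ C₁ : ℝ} {F : ℝ → ℝ} (hs : 0 < s)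
    (hC₀ : 0 ≤ C₀) (hF : HolderSmoothOn q s C₀ F (Set.Icc (-2) 2))
    (hC₁ : ∀ j ≤ q, ∀ y ∈ Set.Icc (-2 : ℝ) 2, |iteratedDerivWithin j F (Set.Icc (-2) 2) y| ≤ C₁)
    {z : ℝ} (hz : z ∈ Set.Icc (-1 : ℝ) 1) :
    ∃ b : ℕ → ℝ, (∀ l, q < l → b l = 0) ∧ (∀ l, |b l| ≤ (q + 1) * (2 ^ q * C₁)) ∧
      ∀ x ∈ Set.Icc (-1 : ℝ) 1,
        |(∑ l ∈ Finset.range (q + 1), b l * x ^ l) - F x| ≤ C₀ * |x - z| ^ (q + s) := by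
  have hz2 : z ∈ Set.Icc (-2 : ℝ) 2 := ⟨by linarith [hz.1], by linarith [hz.2]⟩
  have hC₁0 : 0 ≤ C₁ := (abs_nonneg _).trans (hC₁ 0 (Nat.zero_le q) z hz2)
  refine ⟨fun l => ∑ m ∈ Finset.range (q + 1), iteratedDerivWithin m F (Set.Icc (-2) 2) z /
    m.factorial * ((-z) ^ (m - l) * m.choose l), fun l hl => ?_, fun l => ?_, fun x hx => ?_⟩
  · refine Finset.sum_eq_zero fun m hm => ?_
    rw [Nat.choose_eq_zero_of_lt (by have := Finset.mem_range.1 hm; omega)]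
    simp
  · refine (Finset.abs_sum_le_sum_abs _ _).trans ?_
    refine (Finset.sum_le_card_nsmul _ _ (2 ^ q * C₁) fun m hm => ?_).trans_eq ?_
    · have hmq : m ≤ q := by have := Finset.mem_range.1 hm; omega
      have h1 : |iteratedDerivWithin m F (Set.Icc (-2) 2) z / m.factorial| ≤ C₁ := by
        rw [abs_div, Nat.abs_cast]
        refine (div_le_self (abs_nonneg _) ?_).trans (hC₁ m hmq z hz2)
        exact_mod_cast Nat.succ_le_of_lt m.factorial_pos
      have h2 : |(-z) ^ (m - l)| ≤ 1 := by
        rw [abs_pow, abs_neg]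
        exact pow_le_one₀ (abs_nonneg z) (abs_le.2 hz)
      have h3 : (m.choose l : ℝ) ≤ 2 ^ q := by
        have : m.choose l ≤ 2 ^ q :=
          (Nat.choose_le_two_pow m l).trans (Nat.pow_le_pow_right (by norm_num) hmq)
        exact_mod_cast this
      rw [abs_mul, abs_mul, Nat.abs_cast]
      calc _ ≤ C₁ * (1 * 2 ^ q) := by gcongr
        _ = _ := by ring
    · rw [Finset.card_range, nsmul_eq_mul]
      push_cast
      ring
  · have hx2 : x ∈ Set.Icc (-2 : ℝ) 2 := ⟨by linarith [hx.1], by linarith [hx.2]⟩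
    have h := hF.abs_sub_taylor_le hs hC₀ hz2 q 0 (by simp) x hx2
    rw [abs_sub_comm] at h
    convert h using 3
    · simp only [zero_add, Finset.sum_mul]
      rw [Finset.sum_comm]
      refine Finset.sum_congr rfl fun m hm => ?_
      have hmq := Finset.mem_range.1 hm
      rw [sub_eq_add_neg x z, add_pow, Finset.sum_div, Finset.mul_sum]
      symm
      refine (Finset.sum_subset (Finset.range_subset_range.2 (by omega)) fun l _ hl => ?_).trans
        (Finset.sum_congr rfl fun l _ => by ring)
      rw [Nat.choose_eq_zero_of_lt (by simpa using hl)]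
      simp
    · simp

/-! ### The zigzag coordinate and two-scale localization -/

/-- The coordinate of `x` inside the `i`-th of `N` equal cells of `[-1, 1]`, measured from the left
end for even `i` and from the right end for odd `i`. The alternation makes the coordinates of
neighbouring cells agree at their common end point. -/
noncomputable def zigzag (N i : ℕ) (x : ℝ) : ℝ :=
  if Even i then x - (-1 + i * (2 / N)) else -1 + (i + 1) * (2 / N) - x

/-- The point of the `i`-th of `N` equal cells of `[-1, 1]` with zigzag coordinate `2 j / N²`. -/
noncomputable def zigzagNode (N i j : ℕ) : ℝ :=
  if Even i then -1 + i * (2 / N) + j * (2 / (N : ℝ) ^ 2)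
  else -1 + (i + 1) * (2 / N) - j * (2 / (N : ℝ) ^ 2)

lemma abs_zigzag_sub (N i j : ℕ) (x : ℝ) :
    |zigzag N i x - j * (2 / (N : ℝ) ^ 2)| = |x - zigzagNode N i j| := by
  unfold zigzag zigzagNode
  split_ifs
  · congr 1; ring
  · rw [abs_sub_comm x]; congr 1; ring

lemma zigzag_cell_bounds {N i : ℕ} (hi : i < N) :
    (-1 : ℝ) ≤ -1 + i * (2 / N) ∧ -1 + ((i : ℝ) + 1) * (2 / N) ≤ 1 := by
  have hN : (0 : ℝ) < N := by exact_mod_cast (Nat.zero_le i).trans_lt hi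
  have h1 : (i : ℝ) + 1 ≤ N := by exact_mod_cast hi
  have h2 : ((i : ℝ) + 1) * (2 / N) ≤ N * (2 / N) := by gcongr
  have h3 : (N : ℝ) * (2 / N) = 2 := by field_simp
  have h4 : 0 ≤ (i : ℝ) * (2 / N) := by positivity
  exact ⟨by linarith, by linarith⟩

lemma abs_zigzag_le {N i : ℕ} (hi : i < N) {x : ℝ} (hx : x ∈ Set.Icc (-1 : ℝ) 1) :
    |zigzag N i x| ≤ 2 := by
  obtain ⟨h1, h2⟩ := zigzag_cell_bounds hi
  have h3 : (0 : ℝ) ≤ 2 / N := by positivity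
  obtain ⟨hx1, hx2⟩ := hx
  unfold zigzag
  split_ifs <;> rw [abs_le] <;> constructor <;> linarith

lemma zigzagNode_mem {N i j : ℕ} (hi : i < N) (hj : j < N) :
    zigzagNode N i j ∈ Set.Icc (-1 : ℝ) 1 := by
  obtain ⟨h1, h2⟩ := zigzag_cell_bounds hi
  have h5 : (j : ℝ) * (2 / (N : ℝ) ^ 2) ≤ N * (2 / (N : ℝ) ^ 2) := by gcongr
  have h6 : (N : ℝ) * (2 / (N : ℝ) ^ 2) = 2 / N := by field_simp
  have h7 : 0 ≤ (j : ℝ) * (2 / (N : ℝ) ^ 2) := by positivity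
  unfold zigzagNode
  split_ifs <;> constructor <;> linarith

/-- At a point that is within `ρ` of two cells, the two zigzag coordinates almost agree. -/
lemma abs_zigzag_sub_zigzag_le {N i i' : ℕ} {x ρ : ℝ} (hρ : 0 ≤ ρ) (hρN : ρ < 1 / N)
    (h1 : -1 + i * (2 / N) - ρ ≤ x) (h2 : x ≤ -1 + (i + 1) * (2 / N) + ρ)
    (h1' : -1 + i' * (2 / N) - ρ ≤ x) (h2' : x ≤ -1 + (i' + 1) * (2 / N) + ρ) :
    |zigzag N i' x - zigzag N i x| ≤ 2 * ρ := by
  wlog hle : i ≤ i' generalizing i i'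
  · rw [abs_sub_comm]
    exact this h1' h2' h1 h2 (not_le.1 hle).le
  rcases hle.eq_or_lt with rfl | hlt
  · simpa using hρ
  have hw : (2 : ℝ) / N = 2 * (1 / N) := by ring
  have hi' : i' = i + 1 := by
    by_contra hne
    have h3 : (i : ℝ) + 2 ≤ i' := by
      have : i + 2 ≤ i' := by omega
      exact_mod_cast this
    nlinarith
  subst hi'
  push_cast at h1'
  unfold zigzag
  by_cases he : Even i
  · rw [if_neg (by rw [Nat.even_add_one]; simpa using he), if_pos he, abs_le]
    push_cast
    constructor <;> nlinarith
  · rw [if_pos (by rw [Nat.even_add_one]; exact he), if_neg he, abs_le]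
    push_cast
    constructor <;> nlinarith

/-- The coarse weights applied to the zigzag coordinates: a continuous substitute for the position
of `x` inside its coarse cell. -/
noncomputable def softZigzag (κ : ℝ) (N : ℕ) (x : ℝ) : ℝ :=
  ∑ i ∈ Finset.range N, softCell κ (-1) (2 / N) N i x * zigzag N i x

/-- Two-scale localization: the product of a coarse weight of `x` and a fine weight of (an
approximation `u` to) the zigzag coordinate is negligible unless `x` is close to the corresponding
node. In the transition zone of two coarse cells this holds because their zigzag coordinates
agree there. -/
lemma softCell_mul_softCell_le_or {κ : ℝ} {N i j : ℕ} (hκ : 0 ≤ κ) (hN : 2 ≤ N) (hi : i < N)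
    (hj : j < N) {x u : ℝ} (hx : x ∈ Set.Icc (-1 : ℝ) 1)
    (hu : |u - softZigzag κ N x| ≤ 1 / (N : ℝ) ^ 2)
    (hτ : N * (Real.exp (-(κ * (1 / (N : ℝ) ^ 2))) * 4) ≤ 1 / (N : ℝ) ^ 2) :
    softCell κ (-1) (2 / N) N i x * softCell κ 0 (2 / (N : ℝ) ^ 2) N j u
        ≤ Real.exp (-(κ * (1 / (N : ℝ) ^ 2))) ∨
      |x - zigzagNode N i j| ≤ 11 / (N : ℝ) ^ 2 := by
  have hN0 : (2 : ℝ) ≤ N := by exact_mod_cast hN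
  have hNN : (N : ℝ) * (2 / N) = 2 := by field_simp
  have hNN2 : (N : ℝ) * (2 / (N : ℝ) ^ 2) = 2 / N := by field_simp
  obtain ⟨ρ, hρ⟩ : ∃ ρ : ℝ, ρ = 1 / (N : ℝ) ^ 2 := ⟨_, rfl⟩
  have hρ2 : 2 / (N : ℝ) ^ 2 = 2 * ρ := by rw [hρ]; ring
  have hρ11 : 11 / (N : ℝ) ^ 2 = 11 * ρ := by rw [hρ]; ring
  have hρ0 : 0 < ρ := by rw [hρ]; positivity
  have hρN : ρ < 1 / N := by
    rw [hρ]
    apply one_div_lt_one_div_of_lt (by positivity)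
    nlinarith
  rw [hρ11]
  rw [← hρ] at hu hτ ⊢
  obtain ⟨τ, hτdef⟩ : ∃ τ, τ = Real.exp (-(κ * ρ)) := ⟨_, rfl⟩
  have hτ0 : 0 ≤ τ := by rw [hτdef]; positivity
  have hw : (0 : ℝ) ≤ 2 / N := by positivity
  have coarse : ∀ i' < N, softCell κ (-1) (2 / N) N i' x ≤ τ ∨
      (-1 + i' * (2 / N) - ρ ≤ x ∧ x ≤ -1 + (i' + 1) * (2 / N) + ρ) := fun i' hi' => by
    rw [hτdef]
    exact softCell_le_exp_or_mem hκ hi' (by linarith [hx.1]) (by linarith [hx.2])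
  rw [← hτdef] at hτ ⊢
  rcases coarse i hi with h | ⟨h1, h2⟩
  · left
    have := softCell_le_one (κ := κ) (a := 0) (w := 2 / (N : ℝ) ^ 2) (N := N) j u
    have := softCell_nonneg (κ := κ) (a := -1) (w := 2 / (N : ℝ)) (N := N) hκ hw i x
    nlinarith
  have hz : |softZigzag κ N x - zigzag N i x| ≤ 2 * ρ + N * (τ * 4) := by
    have := abs_sum_mul_sub_le (Finset.range N) (l := fun i' => softCell κ (-1) (2 / N) N i' x)
      (f := fun i' => zigzag N i' x) (c := zigzag N i x) (R := 2 * ρ) (D := 4) (τ := τ)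
      (fun i' _ => softCell_nonneg hκ hw i' x) (sum_softCell (by omega) x) (by positivity) hτ0
      (fun i' hi' => ?_) (fun i' hi' => ?_)
    · simpa [softZigzag] using this
    · have := abs_zigzag_le (Finset.mem_range.1 hi') hx
      have := abs_zigzag_le hi hx
      exact (abs_sub _ _).trans (by linarith)
    · exact (coarse i' (Finset.mem_range.1 hi')).imp_right fun h' =>
        abs_zigzag_sub_zigzag_le hρ0.le hρN h1 h2 h'.1 h'.2
  have hui : |u - zigzag N i x| ≤ 4 * ρ := by
    have := abs_sub_le u (softZigzag κ N x) (zigzag N i x)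
    linarith
  have hzi : -ρ ≤ zigzag N i x ∧ zigzag N i x ≤ 2 / N + ρ := by
    unfold zigzag
    split_ifs <;> constructor <;> linarith
  rw [abs_le] at hui
  -- The approximate coordinate may leave `[0, 2 / N]` by `5 ρ`, hence the larger margin here.
  rcases softCell_le_exp_or_mem (κ := κ) (a := 0) (w := 2 / (N : ℝ) ^ 2) (v := u) (r := 5 * ρ) hκ hj
    (by linarith) (by linarith) with h | ⟨h3, h4⟩
  · left
    have h5 : Real.exp (-(κ * (5 * ρ))) ≤ τ := by
      rw [hτdef]
      apply Real.exp_le_exp.2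
      nlinarith [mul_nonneg hκ hρ0.le]
    have := softCell_le_one (κ := κ) (a := -1) (w := 2 / (N : ℝ)) (N := N) i x
    have := softCell_nonneg (κ := κ) (a := 0) (w := 2 / (N : ℝ) ^ 2) (N := N) hκ (by positivity) j u
    nlinarith
  · right
    rw [← abs_zigzag_sub, abs_le]
    constructor <;> nlinarith

/-- The coefficient of `x ^ l` in the local polynomials on the cells with fine index `j`, weighted
by the coarse soft indicators. -/
noncomputable def coarseCoeff (κ : ℝ) (N : ℕ) (b : ℕ → ℕ → ℕ → ℝ) (j l : ℕ) (x : ℝ) : ℝ :=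
  ∑ i ∈ Finset.range N, b i j l * softCell κ (-1) (2 / N) N i x

/-- The coefficient of `x ^ l` in the local polynomials, weighted by the coarse and the fine soft
indicators; the latter are evaluated at `u x`. -/
noncomputable def blendedCoeff (κ : ℝ) (N : ℕ) (b : ℕ → ℕ → ℕ → ℝ) (u : ℝ → ℝ) (l : ℕ) (x : ℝ) : ℝ :=
  ∑ j ∈ Finset.range N, softCell κ 0 (2 / (N : ℝ) ^ 2) N j (u x) * coarseCoeff κ N b j l x

lemma abs_coarseCoeff_le {κ Kb : ℝ} {N : ℕ} {b : ℕ → ℕ → ℕ → ℝ} (hκ : 0 ≤ κ) (hN : N ≠ 0)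
    {j l : ℕ} (hb : ∀ i < N, |b i j l| ≤ Kb) (x : ℝ) : |coarseCoeff κ N b j l x| ≤ Kb := by
  have hnn := fun i => softCell_nonneg (κ := κ) (a := -1) (w := 2 / N) (N := N) hκ (by positivity) i x
  unfold coarseCoeff
  refine (Finset.abs_sum_le_sum_abs _ _).trans ?_
  calc _ ≤ ∑ i ∈ Finset.range N, Kb * softCell κ (-1) (2 / N) N i x := by
        refine Finset.sum_le_sum fun i hi => ?_
        rw [abs_mul, abs_of_nonneg (hnn i)]
        exact mul_le_mul_of_nonneg_right (hb i (Finset.mem_range.1 hi)) (hnn i)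
    _ = Kb := by rw [← Finset.mul_sum, sum_softCell hN, mul_one]

lemma abs_blendedCoeff_le {κ Kb : ℝ} {N : ℕ} {b : ℕ → ℕ → ℕ → ℝ} (hκ : 0 ≤ κ) (hN : N ≠ 0)
    {l : ℕ} (hb : ∀ i < N, ∀ j < N, |b i j l| ≤ Kb) (u : ℝ → ℝ) (x : ℝ) :
    |blendedCoeff κ N b u l x| ≤ Kb := by
  have hnn := fun j => softCell_nonneg (κ := κ) (a := 0) (w := 2 / (N : ℝ) ^ 2) (N := N) hκ
    (by positivity) j (u x)
  unfold blendedCoeff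
  refine (Finset.abs_sum_le_sum_abs _ _).trans ?_
  calc _ ≤ ∑ j ∈ Finset.range N, softCell κ 0 (2 / (N : ℝ) ^ 2) N j (u x) * Kb := by
        refine Finset.sum_le_sum fun j hj => ?_
        rw [abs_mul, abs_of_nonneg (hnn j)]
        exact mul_le_mul_of_nonneg_left
          (abs_coarseCoeff_le hκ hN (fun i hi => hb i hi j (Finset.mem_range.1 hj)) x) (hnn j)
    _ = Kb := by rw [← Finset.sum_mul, sum_softCell hN, one_mul]

/-- The softly glued local polynomials approximate `F` at the fine scale `N⁻²`. -/
lemma abs_blended_sub_le {κ C₀ p : ℝ} {N q : ℕ} {b : ℕ → ℕ → ℕ → ℝ} {F : ℝ → ℝ} (hκ : 0 ≤ κ)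
    (hN : 2 ≤ N) (hp : 0 ≤ p) (hC₀ : 0 ≤ C₀) {x : ℝ} {u : ℝ → ℝ} (hx : x ∈ Set.Icc (-1 : ℝ) 1)
    (hb : ∀ i < N, ∀ j < N, |(∑ l ∈ Finset.range (q + 1), b i j l * x ^ l) - F x|
      ≤ C₀ * |x - zigzagNode N i j| ^ p)
    (hu : |u x - softZigzag κ N x| ≤ 1 / (N : ℝ) ^ 2)
    (hτ : N * (Real.exp (-(κ * (1 / (N : ℝ) ^ 2))) * 4) ≤ 1 / (N : ℝ) ^ 2) :
    |(∑ l ∈ Finset.range (q + 1), blendedCoeff κ N b u l x * x ^ l) - F x|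
      ≤ C₀ * (11 / (N : ℝ) ^ 2) ^ p +
        (N : ℝ) ^ 2 * (Real.exp (-(κ * (1 / (N : ℝ) ^ 2))) * (C₀ * 2 ^ p)) := by
  have hN0 : N ≠ 0 := by omega
  have h := abs_sum_mul_sub_le (Finset.range N ×ˢ Finset.range N)
    (l := fun ij => softCell κ (-1) (2 / N) N ij.1 x *
      softCell κ 0 (2 / (N : ℝ) ^ 2) N ij.2 (u x))
    (f := fun ij => ∑ l ∈ Finset.range (q + 1), b ij.1 ij.2 l * x ^ l) (c := F x)
    (R := C₀ * (11 / (N : ℝ) ^ 2) ^ p) (D := C₀ * 2 ^ p)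
    (τ := Real.exp (-(κ * (1 / (N : ℝ) ^ 2))))
    (fun ij _ => mul_nonneg (softCell_nonneg hκ (by positivity) _ _)
      (softCell_nonneg hκ (by positivity) _ _)) ?_ (by positivity) (by positivity)
    (fun ij hij => ?_) (fun ij hij => ?_)
  · rw [Finset.card_product, Finset.card_range] at h
    convert h using 2
    · congr 1
      rw [Finset.sum_product]
      simp only [blendedCoeff, coarseCoeff, Finset.sum_mul, Finset.mul_sum]
      conv_lhs => rw [Finset.sum_comm]
      conv_rhs => rw [Finset.sum_comm]
      refine Finset.sum_congr rfl fun j _ => ?_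
      conv_lhs => rw [Finset.sum_comm]
      refine Finset.sum_congr rfl fun i _ => ?_
      refine Finset.sum_congr rfl fun l _ => ?_
      ring
    · push_cast
      ring
  · rw [Finset.sum_product]
    simp only [← Finset.mul_sum, sum_softCell hN0, mul_one]
  · rw [Finset.mem_product, Finset.mem_range, Finset.mem_range] at hij
    have hm := zigzagNode_mem hij.1 hij.2
    refine (hb _ hij.1 _ hij.2).trans ?_
    have : |x - zigzagNode N ij.1 ij.2| ≤ 2 := by
      rw [abs_le]; constructor <;> linarith [hx.1, hx.2, hm.1, hm.2]
    gcongr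
  · rw [Finset.mem_product, Finset.mem_range, Finset.mem_range] at hij
    refine (softCell_mul_softCell_le_or hκ hN hij.1 hij.2 hx hu hτ).imp_right fun h' => ?_
    refine (hb _ hij.1 _ hij.2).trans ?_
    gcongr

/-! ### The layers of the network -/

lemma card_option_sum_le {A B : Type} [Fintype A] [Fintype B] {a b ι : ℕ} (hA : Fintype.card A = a)
    (hB : Fintype.card B = b) (hι : 4 * (a + b + 1) ≤ ι) :
    4 * Fintype.card (Option (A ⊕ B)) ≤ ι := by
  rw [Fintype.card_option, Fintype.card_sum, hA, hB]
  exact hι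

section Layers

variable {ι n k N q : ℕ} {δ B η ε K κ : ℝ} {h : Fin n → ℝ → ℝ}

/-- One layer passes on `x` and computes the coarse soft indicators from it. -/
lemma exists_layer_coarse (hN : N ≠ 0) (hK : 1 ≤ K) (hε : 0 < ε) (hεK : 4 * K * ε ≤ 1)
    (hκ : 0 ≤ κ) (hδ : 3 ≤ δ) (hδκ : 4 * κ ≤ δ) (hι : 4 * (N + 0 + 1) ≤ ι) :
    ∃ h : Fin ι → ℝ → ℝ, Hidden ι δ 1 h ∧
      ApproxReads (4 / ε ^ 2) (2000 * K ^ 4 * ε) h (fun x => x) ∧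
      ∀ i < N, ApproxReads (4 / ε ^ 2) (2000 * K ^ 4 * ε) h
        fun x => softCell κ (-1) (2 / N) N i x := by
  have hε1 : ε ≤ 1 := by nlinarith
  have hx : Reads 1 (fun (_ : Fin 1) (x : ℝ) => x) fun x => x :=
    ⟨fun _ => 1, 0, by simp, by simp, by simp⟩
  have hNN : (N : ℝ) * (2 / N) = 2 := by field_simp
  have h1 : (1 : ℝ) ≤ 4 / ε ^ 2 := by
    rw [le_div_iff₀ (by positivity)]
    nlinarith
  obtain ⟨h, H, hv⟩ := (Hidden.input (ι := ι) (δ := δ)).exists_layer (B := 4 / ε ^ 2)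
    (η := 2000 * K ^ 4 * ε) (by linarith) (by positivity) (S := Option (Fin N ⊕ Empty))
    (v := fun s => s.elim (fun x => x) (Sum.elim (fun i x => softCell κ (-1) (2 / N) N i x) nofun))
    (by
      rintro (_ | (i | i))
      · simpa using hx.approxReads.gadget_id hK (fun x hx => (abs_le.2 hx).trans hK) hε hεK le_rfl
          zero_le_one zero_le_one (by linarith)
      · exact (hx.gadget_softCell hκ (by positivity) i.2
          (by rw [hNN, abs_neg, abs_one]; linarith)).mono h1 (by positivity)
      · exact i.elim)
    (card_option_sum_le (Fintype.card_fin N) (Fintype.card_eq_zero) hι)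
  exact ⟨h, H, hv none, fun i hi => hv (some (Sum.inl ⟨i, hi⟩))⟩

/-- One layer passes on `x` and the coarse soft indicators and multiplies the latter by the zigzag
coordinates. -/
lemma exists_layer_zigzag (H : Hidden ι δ k h) (hκ : 0 ≤ κ) (hK : 2 ≤ K)
    (hε : 0 < ε) (hεK : 4 * K * ε ≤ 1) (hη : 0 ≤ η) (hη1 : η ≤ 1) (hB : 0 ≤ B)
    (hδ : 2 * ε * (B + 1) + 1 ≤ δ) (hι : 4 * (N + N + 1) ≤ ι)
    (hx : ApproxReads B η h (fun x => x))
    (hc : ∀ i < N, ApproxReads B η h fun x => softCell κ (-1) (2 / N) N i x) :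
    ∃ h' : Fin ι → ℝ → ℝ, Hidden ι δ (k + 1) h' ∧
      ApproxReads (4 / ε ^ 2) (2000 * K ^ 4 * (ε + η)) h' (fun x => x) ∧
      (∀ i < N, ApproxReads (4 / ε ^ 2) (2000 * K ^ 4 * (ε + η)) h'
        fun x => softCell κ (-1) (2 / N) N i x) ∧
      ∀ i < N, ApproxReads (4 / ε ^ 2) (2000 * K ^ 4 * (ε + η)) h'
        fun x => softCell κ (-1) (2 / N) N i x * zigzag N i x := by
  have hK1 : 1 ≤ K := by linarith
  have hδ0 : 2 * ε * B + 1 ≤ δ := by nlinarith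
  have hcK : ∀ i, ∀ x ∈ Set.Icc (-1 : ℝ) 1, |softCell κ (-1) (2 / N) N i x| ≤ K := fun i x _ => by
    rw [abs_of_nonneg (softCell_nonneg hκ (by positivity) i x)]
    exact (softCell_le_one i x).trans hK1
  have hzz : ∀ i < N, ApproxReads (B + 1) η h fun x => zigzag N i x := fun i hi => by
    obtain ⟨h1, h2⟩ := zigzag_cell_bounds hi
    have h4 : (0 : ℝ) ≤ 2 / N := by positivity
    by_cases he : Even i
    · simp only [zigzag, if_pos he]
      simpa only [sub_eq_add_neg, add_zero] using (hx.add
        (Reads.const h (-(-1 + i * (2 / (N : ℝ))))).approxReads).mono (B' := B + 1)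
        (by rw [abs_neg]; gcongr; rw [abs_le]; constructor <;> linarith) le_rfl
    · simp only [zigzag, if_neg he]
      have := ((Reads.const h (-1 + ((i : ℝ) + 1) * (2 / N))).approxReads.add
        (hx.const_mul (-1))).mono (B' := B + 1) (η' := η)
        (by
          rw [abs_neg, abs_one, one_mul, add_comm]
          gcongr
          rw [abs_le]; constructor <;> linarith)
        (by simp)
      simpa only [sub_eq_add_neg, neg_mul, one_mul] using this
  obtain ⟨h', H', hv⟩ := H.exists_layer (B := 4 / ε ^ 2) (η := 2000 * K ^ 4 * (ε + η))
    (by linarith [mul_nonneg hε.le hB]) (by positivity) (S := Option (Fin N ⊕ Fin N))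
    (v := fun s => s.elim (fun x => x) (Sum.elim (fun i x => softCell κ (-1) (2 / N) N i x)
      fun i x => softCell κ (-1) (2 / N) N i x * zigzag N i x))
    (by
      rintro (_ | (i | i))
      · exact hx.gadget_id hK1 (fun x hx => (abs_le.2 hx).trans hK1) hε hεK hη hη1 hB hδ0
      · exact (hc i i.2).gadget_id hK1 (hcK i) hε hεK hη hη1 hB hδ0
      · exact ((hc i i.2).mono (by linarith) le_rfl).gadget_mul (hzz i i.2) hK1 (hcK i)
          (fun x hx => (abs_zigzag_le i.2 hx).trans hK) hε hεK hη hη1 (by linarith) hδ)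
    (card_option_sum_le (Fintype.card_fin N) (Fintype.card_fin N) hι)
  exact ⟨h', H', hv none, fun i hi => hv (some (Sum.inl ⟨i, hi⟩)),
    fun i hi => hv (some (Sum.inr ⟨i, hi⟩))⟩

/-- One layer passes on `x`, computes the fine soft indicators of an approximate zigzag coordinate
`u`, and looks up the coefficients of the local polynomials of the coarse cell. -/
lemma exists_layer_fine {b : ℕ → ℕ → ℕ → ℝ} (H : Hidden ι δ k h) (hN : N ≠ 0) (hκ : 0 ≤ κ)
    (hK : 1 ≤ K) (hb : ∀ i < N, ∀ j < N, ∀ l, |b i j l| ≤ K)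
    (hε : 0 < ε) (hεK : 4 * K * ε ≤ 1) (hη : 0 ≤ η) (hη1 : N * K * η ≤ 1) (hB : 1 ≤ B)
    (hδ : 2 * ε * (N * K * B) + 1 ≤ δ) (hδκ : κ * (N * B + 2) ≤ δ)
    (hι : 4 * (N + N * (q + 1) + 1) ≤ ι)
    (hx : ApproxReads B η h (fun x => x))
    (hc : ∀ i < N, ApproxReads B η h fun x => softCell κ (-1) (2 / N) N i x)
    (hz : ∀ i < N, ApproxReads B η h fun x => softCell κ (-1) (2 / N) N i x * zigzag N i x) :
    ∃ u : ℝ → ℝ, (∀ x ∈ Set.Icc (-1 : ℝ) 1, |u x - softZigzag κ N x| ≤ N * η) ∧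
      ∃ h' : Fin ι → ℝ → ℝ, Hidden ι δ (k + 1) h' ∧
      ApproxReads (4 / ε ^ 2) (2000 * K ^ 4 * (ε + N * K * η)) h' (fun x => x) ∧
      (∀ j < N, ApproxReads (4 / ε ^ 2) (2000 * K ^ 4 * (ε + N * K * η)) h'
        fun x => softCell κ 0 (2 / (N : ℝ) ^ 2) N j (u x)) ∧
      ∀ j < N, ∀ l < q + 1, ApproxReads (4 / ε ^ 2) (2000 * K ^ 4 * (ε + N * K * η)) h'
        fun x => coarseCoeff κ N b j l x := by
  have hN1 : (1 : ℝ) ≤ N := by exact_mod_cast Nat.one_le_iff_ne_zero.2 hN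
  have hNK : 1 ≤ (N : ℝ) * K := one_le_mul_of_one_le_of_one_le hN1 hK
  have hB0 : 0 ≤ B := by linarith
  have hNN : (N : ℝ) * (2 / (N : ℝ) ^ 2) ≤ 2 := by
    rw [show (N : ℝ) * (2 / (N : ℝ) ^ 2) = 2 / N by field_simp]
    exact div_le_self zero_le_two hN1
  have h1 : (1 : ℝ) ≤ 4 / ε ^ 2 := by
    rw [le_div_iff₀ (by positivity)]
    nlinarith
  have hηle : η ≤ N * K * η := by nlinarith
  have hBle : B ≤ N * K * B := by nlinarith
  obtain ⟨u, hu, hue⟩ := ApproxReads.sum (Finset.range N) (fun _ => B) (fun _ => η)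
    fun i hi => hz i (Finset.mem_range.1 hi)
  simp only [Finset.sum_const, Finset.card_range, nsmul_eq_mul] at hu hue
  have hcoef : ∀ j < N, ∀ l, ApproxReads (N * K * B) (N * K * η) h
      fun x => coarseCoeff κ N b j l x := fun j hj l => by
    refine (ApproxReads.sum (Finset.range N) (fun _ => K * B) (fun _ => K * η) fun i hi =>
      ((hc i (Finset.mem_range.1 hi)).const_mul (b i j l)).mono ?_ ?_).mono ?_ ?_
    · exact mul_le_mul_of_nonneg_right (hb i (Finset.mem_range.1 hi) j hj l) hB0
    · exact mul_le_mul_of_nonneg_right (hb i (Finset.mem_range.1 hi) j hj l) hη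
    · simp [mul_assoc]
    · simp [mul_assoc]
  obtain ⟨h', H', hv⟩ := H.exists_layer (B := 4 / ε ^ 2) (η := 2000 * K ^ 4 * (ε + N * K * η))
    (by linarith [mul_nonneg hε.le (hB0.trans hBle)]) (by positivity)
    (S := Option (Fin N ⊕ Fin N × Fin (q + 1)))
    (v := fun s => s.elim (fun x => x) (Sum.elim
      (fun j x => softCell κ 0 (2 / (N : ℝ) ^ 2) N j (u x)) fun jl x => coarseCoeff κ N b jl.1 jl.2 x))
    (by
      rintro (_ | (j | ⟨j, l⟩))
      · exact (hx.mono hBle hηle).gadget_id hK (fun x hx => (abs_le.2 hx).trans hK) hε hεK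
          (by positivity) hη1 (by positivity) hδ
      · exact (hu.gadget_softCell hκ (by positivity) j.2 (le_trans
          (mul_le_mul_of_nonneg_left (by rw [abs_zero]; linarith) hκ) hδκ)).mono h1 (by positivity)
      · exact (hcoef j j.2 l).gadget_id hK
          (fun x _ => abs_coarseCoeff_le hκ hN (fun i hi => hb i hi j j.2 l) x) hε hεK
          (by positivity) hη1 (by positivity) hδ)
    (card_option_sum_le (Fintype.card_fin N) (by simp) hι)
  exact ⟨u, hue, h', H', hv none, fun j hj => hv (some (Sum.inl ⟨j, hj⟩)),
    fun j hj l hl => hv (some (Sum.inr ⟨⟨j, hj⟩, ⟨l, hl⟩⟩))⟩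

/-- One layer passes on `x` and multiplies the coefficients by the fine soft indicators, which
makes the coefficients of the blended polynomial available. -/
lemma exists_layer_blended {b : ℕ → ℕ → ℕ → ℝ} {u : ℝ → ℝ} (H : Hidden ι δ k h) (hN : N ≠ 0)
    (hκ : 0 ≤ κ) (hK : 1 ≤ K) (hb : ∀ i < N, ∀ j < N, ∀ l, |b i j l| ≤ K)
    (hε : 0 < ε) (hεK : 4 * K * ε ≤ 1) (hη : 0 ≤ η) (hη1 : η ≤ 1) (hB : 0 ≤ B)
    (hδ : 2 * ε * B + 1 ≤ δ) (hι : 4 * (N * (q + 1) + 0 + 1) ≤ ι)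
    (hx : ApproxReads B η h (fun x => x))
    (hf : ∀ j < N, ApproxReads B η h fun x => softCell κ 0 (2 / (N : ℝ) ^ 2) N j (u x))
    (hc : ∀ j < N, ∀ l < q + 1, ApproxReads B η h fun x => coarseCoeff κ N b j l x) :
    ∃ h' : Fin ι → ℝ → ℝ, Hidden ι δ (k + 1) h' ∧
      ApproxReads (N * (4 / ε ^ 2)) (N * (2000 * K ^ 4 * (ε + η))) h' (fun x => x) ∧
      ∀ l < q + 1, ApproxReads (N * (4 / ε ^ 2)) (N * (2000 * K ^ 4 * (ε + η))) h'
        fun x => blendedCoeff κ N b u l x := by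
  have hN1 : (1 : ℝ) ≤ N := by exact_mod_cast Nat.one_le_iff_ne_zero.2 hN
  obtain ⟨h', H', hv⟩ := H.exists_layer (B := 4 / ε ^ 2) (η := 2000 * K ^ 4 * (ε + η))
    (by linarith [mul_nonneg hε.le hB]) (by positivity)
    (S := Option (Fin N × Fin (q + 1) ⊕ Empty))
    (v := fun s => s.elim (fun x => x) (Sum.elim (fun jl x =>
      softCell κ 0 (2 / (N : ℝ) ^ 2) N jl.1 (u x) * coarseCoeff κ N b jl.1 jl.2 x) nofun))
    (by
      rintro (_ | (⟨j, l⟩ | i))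
      · exact hx.gadget_id hK (fun x hx => (abs_le.2 hx).trans hK) hε hεK hη hη1 hB hδ
      · refine (hf j j.2).gadget_mul (hc j j.2 l l.2) hK (fun x _ => ?_)
          (fun x _ => abs_coarseCoeff_le hκ hN (fun i hi => hb i hi j j.2 l) x) hε hεK hη hη1 hB hδ
        rw [abs_of_nonneg (softCell_nonneg hκ (by positivity) _ _)]
        exact (softCell_le_one _ _).trans hK
      · exact i.elim)
    (card_option_sum_le (by simp) Fintype.card_eq_zero hι)
  refine ⟨h', H', (hv none).mono (le_mul_of_one_le_left (by positivity) hN1)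
    (le_mul_of_one_le_left (by positivity) hN1), fun l hl => ?_⟩
  refine (ApproxReads.sum (Finset.range N) (fun _ => 4 / ε ^ 2)
    (fun _ => 2000 * K ^ 4 * (ε + η)) fun j hj =>
      hv (some (Sum.inl ⟨⟨j, Finset.mem_range.1 hj⟩, ⟨l, hl⟩⟩))).mono ?_ ?_
  · simp
  · simp

end Layers

/-! ### Evaluating a polynomial by repeated folding -/

/-- The coefficients, after `k` folding steps, of the polynomial with coefficients `a`, regarded as
a polynomial in `x ^ 2 ^ k`. -/
noncomputable def foldedCoeff (a : ℕ → ℝ → ℝ) (k m : ℕ) (x : ℝ) : ℝ :=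
  ∑ j ∈ Finset.range (2 ^ k), a (m * 2 ^ k + j) x * x ^ j

lemma foldedCoeff_succ (a : ℕ → ℝ → ℝ) (k m : ℕ) (x : ℝ) :
    foldedCoeff a (k + 1) m x
      = foldedCoeff a k (2 * m) x + x ^ 2 ^ k * foldedCoeff a k (2 * m + 1) x := by
  unfold foldedCoeff
  rw [pow_succ, mul_two, Finset.sum_range_add, Finset.mul_sum]
  congr 1
  · refine Finset.sum_congr rfl fun j _ => ?_
    rw [show m * (2 ^ k + 2 ^ k) + j = 2 * m * 2 ^ k + j by ring]
  · refine Finset.sum_congr rfl fun j _ => ?_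
    rw [show m * (2 ^ k + 2 ^ k) + (2 ^ k + j) = (2 * m + 1) * 2 ^ k + j by ring, pow_add]
    ring

lemma abs_foldedCoeff_le {a : ℕ → ℝ → ℝ} {A : ℝ} {x : ℝ} (hx : x ∈ Set.Icc (-1 : ℝ) 1)
    (ha : ∀ l, |a l x| ≤ A) (k m : ℕ) : |foldedCoeff a k m x| ≤ 2 ^ k * A := by
  unfold foldedCoeff
  refine (Finset.abs_sum_le_sum_abs _ _).trans ?_
  refine (Finset.sum_le_card_nsmul _ _ A fun j _ => ?_).trans_eq (by simp)
  rw [abs_mul, abs_pow]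
  exact (mul_le_of_le_one_right (abs_nonneg _) (pow_le_one₀ (abs_nonneg x) (abs_le.2 hx))).trans
    (ha _)

/-- Each further layer folds the polynomial once, so that after `n` layers its value is the
coefficient of index `0`. -/
lemma exists_layers_folded {ι k₀ n₀ q : ℕ} {δ B η ε K : ℝ} {h : Fin n₀ → ℝ → ℝ} {a : ℕ → ℝ → ℝ}
    {A : ℝ} (H : Hidden ι δ k₀ h) (hK : 1 ≤ K) (hε : 0 < ε) (hεK : 4 * K * ε ≤ 1) (hη : 0 ≤ η)
    (hB : 8 / ε ^ 2 ≤ B) (hδ : 2 * ε * B + 1 ≤ δ) (hι : 4 * ((q + 1) + (q + 1) + 1) ≤ ι)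
    (ha0 : ∀ l, q < l → ∀ x, a l x = 0) (haA : ∀ l, ∀ x ∈ Set.Icc (-1 : ℝ) 1, |a l x| ≤ A)
    (hx : ApproxReads B η h (fun x => x)) (ha : ∀ l < q + 1, ApproxReads B η h (a l)) (n : ℕ)
    (hAK : 2 ^ n * A ≤ K) (hηn : (4 * (2000 * K ^ 4)) ^ n * (η + ε) ≤ 1) :
    ∃ (n' : ℕ) (h' : Fin n' → ℝ → ℝ), Hidden ι δ (k₀ + n) h' ∧
      ApproxReads B ((4 * (2000 * K ^ 4)) ^ n * (η + ε)) h' (fun x => x ^ 2 ^ n) ∧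
      ∀ m, ApproxReads B ((4 * (2000 * K ^ 4)) ^ n * (η + ε)) h' (foldedCoeff a n m) := by
  have hK4 : 1 ≤ K ^ 4 := one_le_pow₀ hK
  have hB0 : 0 ≤ B := le_trans (by positivity) hB
  have hδ0 : 0 ≤ δ := by linarith [mul_nonneg hε.le hB0]
  have hA0 : 0 ≤ A := (abs_nonneg _).trans (haA 0 0 (by simp))
  have h48 : 4 / ε ^ 2 + 4 / ε ^ 2 ≤ B := by
    rw [← add_div]
    norm_num
    exact hB
  induction n with
  | zero =>
    refine ⟨n₀, h, H, by simpa using hx.mono le_rfl (by linarith), fun m => ?_⟩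
    have he : foldedCoeff a 0 m = a m := funext fun x => by simp [foldedCoeff]
    rw [he]
    by_cases hm : m < q + 1
    · exact (ha m hm).mono le_rfl (by simpa using hε.le)
    · rw [show a m = fun _ => 0 from funext fun x => ha0 m (by omega) x]
      exact (Reads.const h 0).approxReads.mono (by simpa using hB0) (by positivity)
  | succ n ih =>
    obtain ⟨Λ, hΛ⟩ : ∃ Λ, Λ = 2000 * K ^ 4 := ⟨_, rfl⟩
    rw [← hΛ] at ih hηn ⊢
    have hΛ1 : 1 ≤ Λ := by rw [hΛ]; linarith
    have hη1 : (4 * Λ) ^ n * (η + ε) ≤ 1 := by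
      refine le_trans ?_ hηn
      gcongr
      · linarith
      · exact Nat.le_succ n
    have hAn : 2 ^ n * A ≤ K := le_trans (by gcongr; norm_num; exact Nat.le_succ n) hAK
    obtain ⟨n', h', H', hX, hcoef⟩ := ih hAn hη1
    have hη0 : 0 ≤ (4 * Λ) ^ n * (η + ε) := by positivity
    have hεle : ε ≤ (4 * Λ) ^ n * (η + ε) := by
      have : 1 ≤ (4 * Λ) ^ n := one_le_pow₀ (by linarith)
      nlinarith
    obtain ⟨e, he⟩ : ∃ e, e = (4 * Λ) ^ n * (η + ε) := ⟨_, rfl⟩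
    rw [← he] at hη1 hX hcoef hη0 hεle
    have hen : (4 * Λ) ^ (n + 1) * (η + ε) = 4 * Λ * e := by rw [he, pow_succ]; ring
    rw [hen]
    have hXK : ∀ x ∈ Set.Icc (-1 : ℝ) 1, |x ^ 2 ^ n| ≤ K := fun x hx => by
      rw [abs_pow]
      exact (pow_le_one₀ (abs_nonneg x) (abs_le.2 hx)).trans hK
    have hcK : ∀ m, ∀ x ∈ Set.Icc (-1 : ℝ) 1, |foldedCoeff a n m x| ≤ K := fun m x hx =>
      (abs_foldedCoeff_le hx (fun l => haA l x hx) n m).trans hAn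
    obtain ⟨g, G, hv⟩ := H'.exists_layer (B := 4 / ε ^ 2) (η := 2000 * K ^ 4 * (ε + e))
      hδ0 (by positivity) (S := Option (Fin (q + 1) ⊕ Fin (q + 1)))
      (v := fun s => s.elim (fun x => x ^ 2 ^ n * x ^ 2 ^ n) (Sum.elim
        (fun m x => foldedCoeff a n (2 * m) x)
        fun m x => x ^ 2 ^ n * foldedCoeff a n (2 * m + 1) x))
      (by
        rintro (_ | (m | m))
        · exact hX.gadget_mul hX hK hXK hXK hε hεK hη0 hη1 hB0 hδ
        · exact (hcoef _).gadget_id hK (hcK _) hε hεK hη0 hη1 hB0 hδ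
        · exact hX.gadget_mul (hcoef _) hK hXK (hcK _) hε hεK hη0 hη1 hB0 hδ)
      (card_option_sum_le (Fintype.card_fin _) (Fintype.card_fin _) hι)
    rw [← hΛ] at hv
    have hle : Λ * (ε + e) + Λ * (ε + e) ≤ 4 * Λ * e := by nlinarith
    have hpos : 0 ≤ Λ * (ε + e) := by positivity
    refine ⟨ι, g, G, ?_, fun m => ?_⟩
    · have := (hv none).mono (B' := B) (η' := 4 * Λ * e) (by linarith) (by linarith)
      convert this using 2
      change _ = _ * _
      rw [← pow_add, pow_succ, mul_two]
    · by_cases hm : m < q + 1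
      · have := ((hv (some (Sum.inl ⟨m, hm⟩))).add (hv (some (Sum.inr ⟨m, hm⟩)))).mono h48 hle
        convert this using 1
        exact funext fun x => foldedCoeff_succ a n m x
      · have : foldedCoeff a (n + 1) m = fun _ => 0 := funext fun x =>
          Finset.sum_eq_zero fun j _ => by
            have : 1 ≤ 2 ^ (n + 1) := Nat.one_le_two_pow
            rw [ha0 _ (by nlinarith), zero_mul]
        rw [this]
        exact (Reads.const g 0).approxReads.mono (by simpa using hB0) (by linarith)

/-! ### The univariate approximation theorem -/

lemma foldedCoeff_zero_eq {a : ℕ → ℝ → ℝ} {q n : ℕ} (hn : q + 1 ≤ 2 ^ n)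
    (ha0 : ∀ l, q < l → ∀ x, a l x = 0) (x : ℝ) :
    foldedCoeff a n 0 x = ∑ l ∈ Finset.range (q + 1), a l x * x ^ l := by
  unfold foldedCoeff
  simp only [zero_mul, zero_add]
  symm
  refine Finset.sum_subset (Finset.range_subset_range.2 hn) fun l _ hl => ?_
  rw [ha0 l (by simpa using hl), zero_mul]

/-- The complete network: it evaluates the blended polynomial up to a small error, for an
approximation `u` to the zigzag coordinate. -/
lemma exists_netClass_blended {ι N q n : ℕ} {δ ε K A κ : ℝ} {b : ℕ → ℕ → ℕ → ℝ} (hN : 2 ≤ N)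
    (hκ : 1 ≤ κ) (hK : 2 ≤ K) (hb0 : ∀ i j l, q < l → b i j l = 0)
    (hb : ∀ i < N, ∀ j < N, ∀ l, |b i j l| ≤ A) (hA : 2 ^ n * A ≤ K) (hn : q + 1 ≤ 2 ^ n)
    (hε : 0 < ε)
    (hη : (4 * (2000 * K ^ 4)) ^ n * (5 * ((2000 * K ^ 4) ^ 4 * (N * (N * K)) * ε)) ≤ 1)
    (hδ : κ * (N * (4 / ε ^ 2) + 4) ≤ δ) (hδ' : 8 * (N * K) / ε + 1 ≤ δ)
    (hι : 4 * (N + N * (q + 1) + 1) ≤ ι) (hι' : 4 * ((q + 1) + (q + 1) + 1) ≤ ι) :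
    ∃ u : ℝ → ℝ,
      (∀ x ∈ Set.Icc (-1 : ℝ) 1, |u x - softZigzag κ N x| ≤ N * (2 * (2000 * K ^ 4) ^ 2 * ε)) ∧
      ∃ g ∈ NetClass 1 (4 + n) ι δ, ∀ x ∈ Set.Icc (-1 : ℝ) 1,
        |g (fun _ => x) - ∑ l ∈ Finset.range (q + 1), blendedCoeff κ N b u l x * x ^ l|
          ≤ (4 * (2000 * K ^ 4)) ^ n * (5 * ((2000 * K ^ 4) ^ 4 * (N * (N * K)) * ε)) := by
  obtain ⟨Λ, hΛ⟩ : ∃ Λ, Λ = 2000 * K ^ 4 := ⟨_, rfl⟩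
  have hK1 : 1 ≤ K := by linarith
  have hκ0 : 0 ≤ κ := by linarith
  have hN0 : N ≠ 0 := by omega
  have hNr : (2 : ℝ) ≤ N := by exact_mod_cast hN
  have hΛ1 : 1 ≤ Λ := by rw [hΛ]; linarith [one_le_pow₀ hK1 (n := 4)]
  have hKΛ : K ≤ Λ := by
    have : K ≤ K ^ 4 := by simpa using pow_le_pow_right₀ hK1 (show 1 ≤ 4 by norm_num)
    rw [hΛ]; linarith
  rw [← hΛ] at hη ⊢
  obtain ⟨T, hT⟩ : ∃ T : ℝ, T = N * K := ⟨_, rfl⟩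
  rw [← hT] at hη hδ' ⊢
  have hT4 : 4 ≤ T := by
    rw [hT, show (4 : ℝ) = 2 * 2 by norm_num]
    gcongr
  have hN1 : (1 : ℝ) ≤ N := by linarith
  have hT1 : 1 ≤ T := by linarith
  have hNT : T ≤ N * T := le_mul_of_one_le_left (by linarith) hN1
  have hA0 : 0 ≤ A := (abs_nonneg _).trans (hb 0 (by omega) 0 (by omega) 0)
  have hAK : A ≤ K := (le_mul_of_one_le_left hA0 (one_le_pow₀ one_le_two)).trans hA
  have hZ : 5 * (Λ ^ 4 * (N * T) * ε) ≤ 1 := by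
    refine le_trans ?_ hη
    exact le_mul_of_one_le_left (by positivity) (one_le_pow₀ (by linarith))
  have hΛ2 : Λ ≤ Λ ^ 2 := by simpa using pow_le_pow_right₀ hΛ1 (show 1 ≤ 2 by norm_num)
  have hΛ3 : Λ ^ 2 ≤ Λ ^ 3 := pow_le_pow_right₀ hΛ1 (by norm_num)
  have hΛ4 : Λ ^ 3 ≤ Λ ^ 4 := pow_le_pow_right₀ hΛ1 (by norm_num)
  have hΛ3T : 5 * (Λ ^ 3 * T * ε) ≤ 1 := by
    refine le_trans ?_ hZ
    gcongr
  have hΛ2T : 5 * (Λ ^ 2 * T * ε) ≤ 1 := by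
    refine le_trans ?_ hΛ3T
    gcongr
  have hΛ2ε : 20 * (Λ ^ 2 * ε) ≤ 1 := by
    refine le_trans ?_ hΛ2T
    rw [show 20 * (Λ ^ 2 * ε) = 5 * (Λ ^ 2 * 4 * ε) by ring]
    gcongr
  have hΛε : 20 * (Λ * ε) ≤ 1 := by
    refine le_trans ?_ hΛ2ε
    gcongr
  have hεK : 4 * K * ε ≤ 1 := by linarith [mul_le_mul_of_nonneg_right hKΛ hε.le]
  have hε1 : ε ≤ 1 := by linarith [le_mul_of_one_le_left hε.le hΛ1]
  have hεsq : 4 ≤ 4 / ε ^ 2 := by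
    rw [le_div_iff₀ (by positivity)]
    linarith [pow_le_one₀ hε.le hε1 (n := 2)]
  have hεB : 2 * ε * (T * (4 / ε ^ 2)) = 8 * T / ε := by field_simp; ring
  have hεN : 2 * ε * (N * (4 / ε ^ 2)) ≤ 8 * T / ε := by
    rw [← hεB, hT]
    gcongr
    exact le_mul_of_one_le_right (by linarith) hK1
  have hεN' : 2 * ε * (2 * (4 / ε ^ 2)) ≤ 8 * T / ε := by
    refine le_trans ?_ hεN
    gcongr
  have hε2 : 2 * ε * (4 / ε ^ 2 + 1) ≤ 8 * T / ε := by
    refine le_trans ?_ hεN'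
    gcongr
    linarith
  have h4pos : 0 ≤ 4 / ε ^ 2 := by positivity
  have hNB : (0 : ℝ) ≤ N * (4 / ε ^ 2) := by positivity
  have hκB : N * (4 / ε ^ 2) + 4 ≤ δ := le_trans (le_mul_of_one_le_left (by positivity) hκ) hδ
  have hκ4 : 4 * κ ≤ δ := by
    refine le_trans ?_ hδ
    rw [mul_comm]
    gcongr
    linarith
  have hNq : N ≤ N * (q + 1) := Nat.le_mul_of_pos_right N (Nat.succ_pos q)
  obtain ⟨h₁, H₁, hx₁, hc₁⟩ := exists_layer_coarse (ι := ι) (δ := δ) hN0 hK1 hε hεK hκ0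
    (by linarith) hκ4 (by linarith)
  rw [← hΛ] at hx₁ hc₁
  obtain ⟨h₂, H₂, hx₂, hc₂, hz₂⟩ := exists_layer_zigzag H₁ hκ0 hK hε hεK (by positivity)
    (by linarith) h4pos (by linarith) (by linarith) hx₁ hc₁
  rw [← hΛ] at hx₂ hc₂ hz₂
  have hη₂ : Λ * (ε + Λ * ε) ≤ 2 * Λ ^ 2 * ε := by
    have : Λ * ε ≤ Λ ^ 2 * ε := by gcongr
    linarith [show Λ * (ε + Λ * ε) = Λ * ε + Λ ^ 2 * ε by ring]
  obtain ⟨u, hu, h₃, H₃, hx₃, hf₃, hc₃⟩ := exists_layer_fine (q := q) (b := b) (K := K)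
    (η := 2 * Λ ^ 2 * ε) H₂ hN0 hκ0 hK1
    (fun i hi j hj l => (hb i hi j hj l).trans hAK) hε hεK (by positivity)
    (by rw [← hT]; linarith [show T * (2 * Λ ^ 2 * ε) = 2 * (Λ ^ 2 * T * ε) by ring])
    (by linarith) (by rw [← hT, hεB]; exact hδ')
    (le_trans (by gcongr; norm_num) hδ) hι (hx₂.mono le_rfl hη₂)
    (fun i hi => (hc₂ i hi).mono le_rfl hη₂) (fun i hi => (hz₂ i hi).mono le_rfl hη₂)
  rw [← hΛ, ← hT] at hx₃ hf₃ hc₃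
  have hη₃ : Λ * (ε + T * (2 * Λ ^ 2 * ε)) ≤ 3 * Λ ^ 3 * T * ε := by
    have : Λ * ε ≤ Λ ^ 3 * T * ε := by
      gcongr
      calc Λ = Λ * 1 := (mul_one Λ).symm
        _ ≤ Λ ^ 3 * T := by
          gcongr
          exact hΛ2.trans hΛ3
    linarith [show Λ * (ε + T * (2 * Λ ^ 2 * ε)) = Λ * ε + 2 * (Λ ^ 3 * T * ε) by ring]
  obtain ⟨h₄, H₄, hx₄, hc₄⟩ := exists_layer_blended (q := q) (b := b) (u := u) (K := K)
    (η := 3 * Λ ^ 3 * T * ε) H₃ hN0 hκ0 hK1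
    (fun i hi j hj l => (hb i hi j hj l).trans hAK) hε hεK (by positivity) (by linarith) h4pos
    (by linarith) (by linarith) (hx₃.mono le_rfl hη₃)
    (fun j hj => (hf₃ j hj).mono le_rfl hη₃) (fun j hj l hl => (hc₃ j hj l hl).mono le_rfl hη₃)
  rw [← hΛ] at hx₄ hc₄
  have hη₄ : N * (Λ * (ε + 3 * Λ ^ 3 * T * ε)) ≤ 4 * (Λ ^ 4 * (N * T) * ε) := by
    have : N * (Λ * ε) ≤ Λ ^ 4 * (N * T) * ε := by
      have : Λ * 1 ≤ Λ ^ 4 * T := by gcongr; linarith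
      calc N * (Λ * ε) = N * ε * (Λ * 1) := by ring
        _ ≤ N * ε * (Λ ^ 4 * T) := by gcongr
        _ = _ := by ring
    linarith [show N * (Λ * (ε + 3 * Λ ^ 3 * T * ε))
      = N * (Λ * ε) + 3 * (Λ ^ 4 * (N * T) * ε) by ring]
  have hε₅ : ε ≤ Λ ^ 4 * (N * T) * ε := by
    have h1 : (1 : ℝ) ≤ Λ ^ 4 := one_le_pow₀ hΛ1
    exact le_mul_of_one_le_left hε.le (one_le_mul_of_one_le_of_one_le h1 (by linarith))
  have hη₅ : (4 * Λ) ^ n * (4 * (Λ ^ 4 * (N * T) * ε) + ε)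
      ≤ (4 * Λ) ^ n * (5 * (Λ ^ 4 * (N * T) * ε)) := by
    gcongr
    linarith
  have ha0 : ∀ l, q < l → ∀ x, blendedCoeff κ N b u l x = 0 := fun l hl x => by
    simp [blendedCoeff, coarseCoeff, hb0 _ _ l hl]
  obtain ⟨n', h', H', -, hfin⟩ := exists_layers_folded (q := q) (K := K) (A := A)
    (a := fun l => blendedCoeff κ N b u l) H₄ hK1 hε hεK (η := 4 * (Λ ^ 4 * (N * T) * ε))
    (B := N * (4 / ε ^ 2)) (by positivity)
    (by rw [show 8 / ε ^ 2 = 2 * (4 / ε ^ 2) by ring]; gcongr) (by linarith) hι' ha0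
    (fun l x _ => abs_blendedCoeff_le hκ0 hN0 (fun i hi j hj => hb i hi j hj l) u x)
    (hx₄.mono le_rfl hη₄) (fun l hl => (hc₄ l hl).mono le_rfl hη₄) n hA
    (by rw [← hΛ]; exact hη₅.trans hη)
  rw [← hΛ] at hfin
  obtain ⟨r, hr, hre⟩ := hfin 0
  refine ⟨u, hu, _, H'.mem_netClass (hr.mono (by linarith)), fun x hx => ?_⟩
  rw [← foldedCoeff_zero_eq hn ha0]
  exact (hre x hx).trans hη₅

lemma four_mul_le_widthC5 {q M : ℕ} (hM : 1 ≤ M) :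
    4 * (M + M * (q + 1) + 1) ≤ widthC5 1 q M ∧
      4 * ((q + 1) + (q + 1) + 1) ≤ widthC5 1 q M := by
  have h : 2 * ((1 + q + 1) * M * 4 + 1 + M * 4 + 12) ≤ widthC5 1 q M := by
    unfold widthC5
    simp only [Nat.choose_one_right, pow_one]
    gcongr
    exact le_max_left _ _
  constructor <;> nlinarith

lemma le_boundC6 {p C₁ : ℝ} {M : ℕ} (hM : 1 ≤ M) :
    ((M : ℝ) ^ (2 * p)) ^ 5 * (M : ℝ) ^ 12 ≤ boundC6 1 p 1 M 1 (max 1 C₁) := by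
  have hM0 : (0 : ℝ) < M := by exact_mod_cast hM
  have h1 : (M : ℝ) ^ (10 * p + 2 * (1 : ℕ) + 10) = ((M : ℝ) ^ (2 * p)) ^ 5 * (M : ℝ) ^ 12 := by
    rw [← Real.rpow_natCast, ← Real.rpow_natCast, ← Real.rpow_mul hM0.le, ← Real.rpow_add hM0]
    congr 1
    push_cast
    ring
  unfold boundC6
  rw [h1, one_mul]
  have h2 : 1 ≤ Real.exp (6 * 2 ^ (2 * (1 + 1) + 1) * (1 : ℕ) * 1) :=
    Real.one_le_exp (by positivity)
  have h3 : 1 ≤ (max 1 C₁) ^ 12 := one_le_pow₀ (le_max_left 1 C₁)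
  have h4 : 0 ≤ ((M : ℝ) ^ (2 * p)) ^ 5 * (M : ℝ) ^ 12 := by positivity
  calc _ ≤ Real.exp (6 * 2 ^ (2 * (1 + 1) + 1) * (1 : ℕ) * 1) *
        (((M : ℝ) ^ (2 * p)) ^ 5 * (M : ℝ) ^ 12) := le_mul_of_one_le_left h4 h2
    _ ≤ _ := le_mul_of_one_le_right (by positivity) h3

set_option maxHeartbeats 1000000 in
/-- Fully connected sigmoid networks of width `O(M)` and of the stated depth and parameter bound
approximate Hölder smooth functions on `[-1, 1]` at the rate `M ^ (-2 p)`, once `M` is large. -/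
theorem exists_netClass_approx {p s C₀ C₁ : ℝ} {q : ℕ} (hs : 0 < s) (hp : p = q + s)
    (hC₀ : 0 < C₀) (hC₁ : 0 < C₁) :
    ∃ C : ℝ, 0 < C ∧ ∃ M₀ : ℕ, ∀ F : ℝ → ℝ, HolderSmoothOn q s C₀ F (Set.Icc (-2) 2) →
      (∀ j ≤ q, ∀ y ∈ Set.Icc (-2 : ℝ) 2, |iteratedDerivWithin j F (Set.Icc (-2) 2) y| ≤ C₁) →
      ∀ M : ℕ, M₀ ≤ M →
        ∃ g ∈ NetClass 1 (depthC4 1 q) (widthC5 1 q M) (boundC6 1 p 1 M 1 (max 1 C₁)),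
          ∀ x ∈ Set.Icc (-1 : ℝ) 1, |g (fun _ => x) - F x| ≤ C / (M : ℝ) ^ (2 * p) := by
  have hp0 : 0 < p := by rw [hp]; positivity
  obtain ⟨n, hn⟩ : ∃ n, n = 4 + Nat.clog 2 (max 1 (q + 1)) := ⟨_, rfl⟩
  have hqn : q + 1 ≤ 2 ^ n := by
    calc q + 1 ≤ max 1 (q + 1) := le_max_right _ _
      _ ≤ 2 ^ Nat.clog 2 (max 1 (q + 1)) := Nat.le_pow_clog (by norm_num) _
      _ ≤ 2 ^ n := Nat.pow_le_pow_right (by norm_num) (by omega)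
  obtain ⟨A, hA⟩ : ∃ A : ℝ, A = (q + 1) * (2 ^ q * C₁) := ⟨_, rfl⟩
  have hA0 : 0 ≤ A := by rw [hA]; positivity
  obtain ⟨K, hK⟩ : ∃ K : ℝ, K = 2 + 2 ^ n * A := ⟨_, rfl⟩
  have hK2 : 2 ≤ K := by rw [hK]; linarith [mul_nonneg (pow_nonneg zero_le_two n) hA0]
  have hAK : 2 ^ n * A ≤ K := by rw [hK]; linarith
  obtain ⟨Q, hQ⟩ : ∃ Q : ℝ, Q = (4 * (2000 * K ^ 4)) ^ n * (5 * ((2000 * K ^ 4) ^ 4 * K)) := ⟨_, rfl⟩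
  have hQ0 : 0 < Q := by rw [hQ]; positivity
  have hcast := tendsto_natCast_atTop_atTop (R := ℝ)
  have ev1 : ∀ᶠ M : ℕ in Filter.atTop, 2 * (2000 * K ^ 4) ^ 2 ≤ (M : ℝ) ^ (2 * p) :=
    ((tendsto_rpow_atTop (by positivity : 0 < 2 * p)).comp hcast).eventually_ge_atTop _
  have ev2 : ∀ᶠ M : ℕ in Filter.atTop, Q + 8 * K + 1 ≤ (M : ℝ) := hcast.eventually_ge_atTop _
  have ev3 : ∀ᶠ M : ℕ in Filter.atTop, 4 * (M : ℝ) ^ 3 * (M : ℝ) ^ (2 * p) * Real.exp (-M) ≤ 1 := by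
    have h := ((isLittleO_rpow_exp_atTop (3 + 2 * p)).comp_tendsto hcast).bound
      (show (0 : ℝ) < 1 / 4 by norm_num)
    filter_upwards [h, Filter.eventually_ge_atTop 1] with M h1 hM
    have hM0 : (0 : ℝ) < M := by exact_mod_cast hM
    simp only [Function.comp_apply, Real.norm_eq_abs, Real.abs_exp,
      Real.abs_rpow_of_nonneg hM0.le, abs_of_pos hM0] at h1
    rw [Real.rpow_add hM0] at h1
    have h2 : (M : ℝ) ^ (3 : ℝ) = (M : ℝ) ^ 3 := by exact_mod_cast Real.rpow_natCast (M : ℝ) 3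
    rw [h2] at h1
    rw [Real.exp_neg, ← div_eq_mul_inv, div_le_one (Real.exp_pos _)]
    linarith
  obtain ⟨M₀, hM₀⟩ := Filter.eventually_atTop.1 (ev1.and (ev2.and ev3))
  refine ⟨Q + C₀ * 11 ^ p + C₀ * 2 ^ p, by positivity, M₀, fun F hF hFC M hM => ?_⟩
  obtain ⟨e1, e2, e3⟩ := hM₀ M hM
  have hM17 : (17 : ℝ) ≤ M := by linarith
  have hM2 : 2 ≤ M := by
    have : (2 : ℝ) ≤ M := by linarith
    exact_mod_cast this
  have hm1 : (1 : ℝ) ≤ M := by linarith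
  have hm0 : (0 : ℝ) < M := by linarith
  have hP1 : 1 ≤ (M : ℝ) ^ (2 * p) := Real.one_le_rpow hm1 (by positivity)
  have hδ := le_boundC6 (p := p) (C₁ := C₁) (M := M) (by omega)
  have hpow : (11 / (M : ℝ) ^ 2) ^ p = 11 ^ p / (M : ℝ) ^ (2 * p) := by
    rw [Real.div_rpow (by norm_num) (by positivity), ← Real.rpow_natCast, ← Real.rpow_mul hm0.le]
    norm_num
  obtain ⟨hι, hι'⟩ := four_mul_le_widthC5 (q := q) (M := M) (by omega)
  have hdepth : depthC4 1 q = 4 + n := by rw [hn, depthC4]; omega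
  rw [hdepth]
  have hloc : ∀ i j, ∃ b : ℕ → ℝ, i < M → j < M → (∀ l, q < l → b l = 0) ∧ (∀ l, |b l| ≤ A) ∧
      ∀ x ∈ Set.Icc (-1 : ℝ) 1, |(∑ l ∈ Finset.range (q + 1), b l * x ^ l) - F x|
        ≤ C₀ * |x - zigzagNode M i j| ^ p := fun i j => by
    by_cases hij : i < M ∧ j < M
    · obtain ⟨b, h1, h2, h3⟩ :=
        hF.exists_local_polynomial hs hC₀.le hFC (zigzagNode_mem hij.1 hij.2)
      rw [← hp] at h3
      exact ⟨b, fun _ _ => ⟨h1, by rw [hA]; exact h2, h3⟩⟩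
    · exact ⟨0, fun hi hj => absurd ⟨hi, hj⟩ hij⟩
  choose b₀ hb₀ using hloc
  -- Outside the grid the coefficients play no role; they are set to zero to have degree `≤ q`.
  obtain ⟨b, hb⟩ : ∃ b : ℕ → ℕ → ℕ → ℝ, b = fun i j => if i < M ∧ j < M then b₀ i j else 0 :=
    ⟨_, rfl⟩
  have hbij : ∀ i < M, ∀ j < M, b i j = b₀ i j := fun i hi j hj => by rw [hb]; simp [hi, hj]
  obtain ⟨P, hP⟩ : ∃ P : ℝ, P = (M : ℝ) ^ (2 * p) := ⟨_, rfl⟩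
  obtain ⟨m, hm⟩ : ∃ m : ℝ, m = M := ⟨_, rfl⟩
  have hκ : (M : ℝ) ^ 3 * (1 / (M : ℝ) ^ 2) = M := by field_simp
  rw [← hP] at e1 e3 hP1 hδ hpow ⊢
  have hP0 : 0 < P := by linarith
  have hεsq : 4 / (1 / (P * (M : ℝ) ^ 3)) ^ 2 = 4 * P ^ 2 * (M : ℝ) ^ 6 := by
    field_simp
  have hQε : (4 * (2000 * K ^ 4)) ^ n *
      (5 * ((2000 * K ^ 4) ^ 4 * (M * (M * K)) * (1 / (P * (M : ℝ) ^ 3)))) = Q / (P * M) := by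
    rw [hQ]; field_simp
  -- The scale `ε = 1 / (P M³)`: the product layer has `M` terms per coefficient and is fed by sums
  -- of `M` terms, which costs `M²`; the third factor `M` beats the constants.
  obtain ⟨u, hu, g, hg, hge⟩ := exists_netClass_blended (ι := widthC5 1 q M)
    (δ := boundC6 1 p 1 M 1 (max 1 C₁)) (ε := 1 / (P * (M : ℝ) ^ 3)) (A := A) (b := b) (n := n)
    (q := q) hM2 (κ := (M : ℝ) ^ 3) (one_le_pow₀ hm1) hK2
    (fun i j l hl => by
      rw [hb]
      dsimp only
      split_ifs with hij
      · exact (hb₀ i j hij.1 hij.2).1 l hl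
      · rfl)
    (fun i hi j hj l => by rw [hbij i hi j hj]; exact (hb₀ i j hi hj).2.1 l)
    hAK hqn (by positivity)
    (by
      rw [hQε, div_le_one (by positivity)]
      nlinarith)
    (by
      refine le_trans ?_ hδ
      rw [hεsq, ← hm]
      rw [← hm] at hM17 hm1 hm0
      have h1 : m ^ 3 * 1 ≤ m ^ 10 * P ^ 2 :=
        mul_le_mul (pow_le_pow_right₀ hm1 (by norm_num)) (one_le_pow₀ hP1) zero_le_one (by positivity)
      have h2 : m ^ 10 * P ^ 2 * 8 ≤ m ^ 10 * P ^ 5 * m ^ 2 :=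
        mul_le_mul (mul_le_mul_of_nonneg_left (pow_le_pow_right₀ hP1 (by norm_num)) (by positivity))
          (by nlinarith) (by norm_num) (by positivity)
      calc _ = 4 * (m ^ 10 * P ^ 2) + 4 * (m ^ 3 * 1) := by ring
        _ ≤ m ^ 10 * P ^ 2 * 8 := by linarith
        _ ≤ _ := h2
        _ = _ := by ring)
    (by
      refine le_trans ?_ hδ
      rw [← hm] at hm1 hm0 e2 ⊢
      have h1 : 1 ≤ P * m ^ 4 := one_le_mul_of_one_le_of_one_le hP1 (one_le_pow₀ hm1)
      have h2 : 8 * K + 1 ≤ m := by linarith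
      have h3 : P ≤ P ^ 5 := by simpa using pow_le_pow_right₀ hP1 (show 1 ≤ 5 by norm_num)
      calc 8 * (m * K) / (1 / (P * m ^ 3)) + 1 = 8 * K * (P * m ^ 4) + 1 := by field_simp
        _ ≤ (8 * K + 1) * (P * m ^ 4) := by linarith
        _ ≤ m * (P * m ^ 4) := by gcongr
        _ = P * m ^ 5 := by ring
        _ ≤ P ^ 5 * m ^ 12 := by
          gcongr
          norm_num)
    hι hι'
  rw [hQε] at hge
  refine ⟨g, hg, fun x hx => ?_⟩
  have hu' : |u x - softZigzag ((M : ℝ) ^ 3) M x| ≤ 1 / (M : ℝ) ^ 2 := by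
    refine (hu x hx).trans ?_
    calc _ = 2 * (2000 * K ^ 4) ^ 2 / (P * (M : ℝ) ^ 2) := by field_simp
      _ ≤ P / (P * (M : ℝ) ^ 2) := by gcongr
      _ = _ := by field_simp
  have hexp := Real.exp_pos (-(M : ℝ))
  have hB := abs_blended_sub_le (F := F) (q := q) (b := b) (p := p) (C₀ := C₀) (N := M)
    (κ := (M : ℝ) ^ 3) (u := u) (by positivity) hM2 hp0.le hC₀.le hx
    (fun i hi j hj => by rw [hbij i hi j hj]; exact (hb₀ i j hi hj).2.2 x hx) hu'
    (by
      rw [hκ, le_div_iff₀ (by positivity)]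
      calc M * (Real.exp (-M) * 4) * (M : ℝ) ^ 2 = 4 * (M : ℝ) ^ 3 * 1 * Real.exp (-M) := by ring
        _ ≤ 4 * (M : ℝ) ^ 3 * P * Real.exp (-M) := by gcongr
        _ ≤ 1 := e3)
  rw [hκ, hpow] at hB
  have h1 : (M : ℝ) ^ 2 * Real.exp (-M) ≤ 1 / P := by
    rw [le_div_iff₀ hP0]
    refine le_trans ?_ e3
    have h2 : (M : ℝ) ^ 2 ≤ 4 * (M : ℝ) ^ 3 := by nlinarith
    calc _ = (M : ℝ) ^ 2 * P * Real.exp (-M) := by ring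
      _ ≤ _ := by gcongr
  have h2 : Q / (P * M) ≤ Q / P := by
    gcongr
    nlinarith
  have h3 : (M : ℝ) ^ 2 * (Real.exp (-M) * (C₀ * 2 ^ p)) ≤ C₀ * 2 ^ p / P := by
    calc _ = (M : ℝ) ^ 2 * Real.exp (-M) * (C₀ * 2 ^ p) := by ring
      _ ≤ 1 / P * (C₀ * 2 ^ p) := by gcongr
      _ = _ := by ring
  refine (abs_sub_le _ (∑ l ∈ Finset.range (q + 1),
    blendedCoeff ((M : ℝ) ^ 3) M b u l x * x ^ l) _).trans ?_
  calc _ ≤ Q / (P * M) + (C₀ * (11 ^ p / P) +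
        (M : ℝ) ^ 2 * (Real.exp (-M) * (C₀ * 2 ^ p))) := add_le_add (hge x hx) hB
    _ ≤ Q / P + (C₀ * (11 ^ p / P) + C₀ * 2 ^ p / P) := by linarith
    _ = _ := by ring

lemma netClass_nonempty {D L ι : ℕ} {δ : ℝ} (hδ : 0 ≤ δ) : (NetClass D L ι δ).Nonempty := by
  suffices h : ∃ θ : DenseNet ι D L, θ.ParamBound δ by
    obtain ⟨θ, hθ⟩ := h
    exact ⟨_, θ, hθ, rfl⟩
  induction L generalizing D with
  | zero => exact ⟨DenseNet.output 0 0, fun i => by simpa using hδ, by simpa using hδ⟩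
  | succ L ih =>
    obtain ⟨θ, hθ⟩ := ih (D := ι)
    exact ⟨DenseNet.layer 0 0 θ, fun i j => by simpa using hδ, fun i => by simpa using hδ, hθ⟩

/-- The univariate approximation for every `M ≥ 1`, composed with a feature with values in
`[-1, 1]`. Below the threshold of the univariate theorem the zero function is accurate enough,
because the constant may depend on the bound `C₁`. -/
theorem exists_featureNetClass_approx {p s C₀ C₁ : ℝ} {q : ℕ} (hs : 0 < s) (hp : p = q + s)
    (hC₀ : 0 < C₀) (hC₁ : 0 < C₁) :
    ∃ C : ℝ, 0 < C ∧ ∀ F : ℝ → ℝ, HolderSmoothOn q s C₀ F (Set.Icc (-2) 2) →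
      (∀ j ≤ q, ∀ y ∈ Set.Icc (-2 : ℝ) 2, |iteratedDerivWithin j F (Set.Icc (-2) 2) y| ≤ C₁) →
      ∀ M : ℕ, 1 ≤ M → ∀ (d : ℕ) (φ : (Fin d → ℝ) → ℝ), (∀ x, φ x ∈ Set.Icc (-1 : ℝ) 1) →
        ∃ fnet ∈ FeatureNetClass (singleFeature φ) (depthC4 1 q) (widthC5 1 q M)
          (boundC6 1 p 1 M 1 (max 1 C₁)),
          ∀ x, |fnet x - F (φ x)| ≤ C / (M : ℝ) ^ (2 * p) := by
  have hp0 : 0 < p := by rw [hp]; positivity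
  obtain ⟨C, hC, M₀, h⟩ := exists_netClass_approx (C₀ := C₀) (C₁ := C₁) hs hp hC₀ hC₁
  refine ⟨C + C₁ * (M₀ : ℝ) ^ (2 * p), by positivity, fun F hF hFC M hM d φ hφ => ?_⟩
  have hMp : 0 < (M : ℝ) ^ (2 * p) := by positivity
  by_cases hMM : M₀ ≤ M
  · obtain ⟨g, hg, hge⟩ := h F hF hFC M hMM
    refine ⟨_, ⟨fun _ => 1, 0, fun _ => g, fun _ => hg, rfl⟩, fun x => ?_⟩
    simp only [Finset.univ_unique, Finset.sum_singleton, one_mul, add_zero]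
    refine (hge (φ x) (hφ x)).trans ?_
    gcongr
    linarith [mul_nonneg hC₁.le (Real.rpow_nonneg (Nat.cast_nonneg (α := ℝ) M₀) (2 * p))]
  · obtain ⟨g, hg⟩ := netClass_nonempty (D := 1) (L := depthC4 1 q) (ι := widthC5 1 q M)
      (δ := boundC6 1 p 1 M 1 (max 1 C₁)) (by unfold boundC6; positivity)
    refine ⟨_, ⟨fun _ => 0, 0, fun _ => g, fun _ => hg, rfl⟩, fun x => ?_⟩
    have hF0 := hFC 0 (Nat.zero_le q) (φ x) ⟨by linarith [(hφ x).1], by linarith [(hφ x).2]⟩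
    rw [iteratedDerivWithin_zero] at hF0
    have hMM' : (M : ℝ) ^ (2 * p) ≤ (M₀ : ℝ) ^ (2 * p) := by
      have : (M : ℝ) ≤ M₀ := by exact_mod_cast (not_le.1 hMM).le
      gcongr
    simp only [zero_mul, Finset.sum_const_zero, add_zero, zero_sub, abs_neg]
    rw [le_div_iff₀ hMp]
    calc |F (φ x)| * (M : ℝ) ^ (2 * p) ≤ C₁ * (M₀ : ℝ) ^ (2 * p) := by gcongr
      _ ≤ _ := by linarith

theorem theorem3 (p : ℝ) (q : ℕ) (s : ℝ) (hs₀ : 0 < s) (hs₁ : s ≤ 1) (hp : p = q + s) :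
    ∃ c₂ c₃ c₆ : ℝ, 0 < c₂ ∧ 0 < c₃ ∧ 0 < c₆ ∧
      ∀ C₀ C₁ : ℝ, 0 < C₀ → 0 < C₁ →
        ∃ C₂' : ℝ, 0 < C₂' ∧
          ∀ F : ℝ → ℝ, HolderSmoothOn q s C₀ F (Set.Icc (-2) 2) →
            (∀ j ≤ q, ∀ y ∈ Set.Icc (-2 : ℝ) 2,
              |iteratedDerivWithin j F (Set.Icc (-2) 2) y| ≤ C₁) →
            ∀ M : ℕ,
              max (max (2 * c₂ * (max 1 C₁) ^ (5 * q + 3)) c₃) 12 ≤ (M : ℝ) ^ (2 * p) →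
              ∀ (d : ℕ) (k : Fin d → ℝ),
                (∃ fnet ∈ FeatureNetClass (singleFeature fun x => Real.sin (∑ i, k i * x i))
                    (depthC4 1 q) (widthC5 1 q M) (boundC6 c₆ p 1 M 1 (max 1 C₁)),
                  ∀ x : Fin d → ℝ, (∀ i, x i ∈ Set.Icc (-Real.pi) Real.pi) →
                    |fnet x - F (Real.sin (∑ i, k i * x i))| ≤ C₂' / (M : ℝ) ^ (2 * p)) ∧
                (∃ fnet ∈ FeatureNetClass (singleFeature fun x => Real.cos (∑ i, k i * x i))
                    (depthC4 1 q) (widthC5 1 q M) (boundC6 c₆ p 1 M 1 (max 1 C₁)),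
                  ∀ x : Fin d → ℝ, (∀ i, x i ∈ Set.Icc (-Real.pi) Real.pi) →
                    |fnet x - F (Real.cos (∑ i, k i * x i))| ≤ C₂' / (M : ℝ) ^ (2 * p)) := by
  refine ⟨1, 1, 1, one_pos, one_pos, one_pos, fun C₀ C₁ hC₀ hC₁ => ?_⟩
  obtain ⟨C, hC, h⟩ := exists_featureNetClass_approx (C₀ := C₀) (C₁ := C₁) hs₀ hp hC₀ hC₁
  refine ⟨C, hC, fun F hF hFC M hM d k => ?_⟩
  have hp0 : 0 < p := by rw [hp]; positivity
  have hM1 : 1 ≤ M := by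
    by_contra hM0
    obtain rfl : M = 0 := by omega
    rw [Nat.cast_zero, Real.zero_rpow (by positivity)] at hM
    linarith [(le_max_right _ _).trans hM]
  constructor
  · obtain ⟨f, hf, hfe⟩ := h F hF hFC M hM1 d (fun x => Real.sin (∑ i, k i * x i))
      fun x => Real.sin_mem_Icc _
    exact ⟨f, hf, fun x _ => hfe x⟩
  · obtain ⟨f, hf, hfe⟩ := h F hF hFC M hM1 d (fun x => Real.cos (∑ i, k i * x i))
      fun x => Real.cos_mem_Icc _
    exact ⟨f, hf, fun x _ => hfe x⟩
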